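/- Let $n\ge 1$ be an integer, $\alpha>0$, $\beta>0$, and let $$D_n(t,\alpha,\beta)=\det\left(\int_0^1 x^{j+k}\,x^{\alpha}(1-x)^{\beta}e^{-t/x}\,dx\right)_{j,k=0}^{n-1},\qquad \operatorname{Re} t\ge 0,$$ be the Hankel determinant of the Pollaczek–Jacobi type weight. If $\alpha\notin\mathbb Z$, then $t\mapsto D_n(t,\alpha,\beta)$ has an analytic continuation to $|\arg t|<\pi$, again denoted $D_n(t,\alpha,\beta)$, and as $t\to 0$ in $|\arg t|<\pi$ $$D_n(t,\alpha,\beta)=D_n(0,\alpha,\beta)\left[A(t)+\frac{\Gamma(n+\alpha+1)\,\Gamma(n+1+\alpha+\beta)\,\pi\,t^{\alpha+1}}{\Gamma(\beta+1)\Gamma(\alpha+1)\Gamma(\alpha+2)^2\sin(\alpha\pi)\,(n-1)!\,\prod_{j=1}^{n-1}(\beta+j)}\,B(t)+O\!\left(t^{2(\alpha+1)}\right)\right],$$ where $t^{\alpha+1}$ is the principal branch and $A$, $B$ are analytic at $t=0$ with $$A(t)=1-\frac{n(n+\alpha+\beta)}{\alpha}\,t+\frac{n(n+\alpha+\beta)\,\bigl(n(n+\alpha+\beta)\alpha+\beta\bigr)}{2\alpha(\alpha^2-1)}\,t^2+O(t^3),\qquad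 B(t)=1+O(t).$$ Moreover, for all $\alpha,\beta>0$, $$D_n(0,\alpha,\beta)=4^{-n(n+\alpha+\beta)}(2\pi)^n\,\frac{\Gamma\left(\frac{\alpha+\beta+1}{2}\right)G^2\left(\frac{\alpha+\beta+1}{2}\right)G^2\left(\frac{\alpha+\beta}{2}+1\right)}{G(\alpha+\beta+1)\,G(\alpha+1)\,G(\beta+1)}\cdot\frac{G(n+1)\,G(n+\alpha+1)\,G(n+\beta+1)\,G(n+\alpha+\beta+1)}{G^2\left(n+\frac{\alpha+\beta+1}{2}\right)G^2\left(n+1+\frac{\alpha+\beta}{2}\right)\Gamma\left(n+\frac{\alpha+\beta+1}{2}\right)},$$ where $G$ is the Barnes $G$-function. -/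

import Mathlib

open Filter Topology Asymptotics

noncomputable section

/-- The Pollaczek-Jacobi type weight `x^α (1-x)^β e^{-t/x}` on `[0,1]`; the parameter `t` may be
complex. -/
def pjWeight (t : ℂ) (α β x : ℝ) : ℂ :=
  ((x ^ α * (1 - x) ^ β : ℝ) : ℂ) * Complex.exp (-t / (x : ℂ))

/-- The moment `μ_m(t) = ∫₀¹ x^m w(x; t, α, β) dx`. -/
def pjMoment (m : ℕ) (t : ℂ) (α β : ℝ) : ℂ :=
  ∫ x in (0 : ℝ)..1, (x : ℂ) ^ m * pjWeight t α β x

/-- The Hankel determinant `D_n(t, α, β) = det (μ_{j+k}(t))_{j,k=0}^{n-1}`. -/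
def hankelD (n : ℕ) (t : ℂ) (α β : ℝ) : ℂ :=
  Matrix.det (Matrix.of fun j k : Fin n => pjMoment ((j : ℕ) + (k : ℕ)) t α β)

/-- The Barnes `G`-function, through its Weierstrass product
`G(1+w) = (2π)^{w/2} exp(-(w + w²(1+γ))/2) ∏_{k≥1} (1 + w/k)^k exp(w²/(2k) - w)`. -/
def barnesG (z : ℂ) : ℂ :=
  (2 * (Real.pi : ℂ)) ^ ((z - 1) / 2)
    * Complex.exp (-((z - 1) + (z - 1) ^ 2 * (1 + (Real.eulerMascheroniConstant : ℂ))) / 2)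
    * ∏' k : ℕ, ((1 + (z - 1) / ((k : ℂ) + 1)) ^ (k + 1)
        * Complex.exp ((z - 1) ^ 2 / (2 * ((k : ℂ) + 1)) - (z - 1)))

/-- The coefficient of `t^{α+1}` in the expansion of `D_n(t, α, β) / D_n(0, α, β)`. -/
def nonanalyticCoeff (n : ℕ) (α β : ℝ) : ℝ :=
  Real.Gamma (n + α + 1) * Real.Gamma (n + 1 + α + β) * Real.pi /
    (Real.Gamma (β + 1) * Real.Gamma (α + 1) * Real.Gamma (α + 2) ^ 2 * Real.sin (α * Real.pi)
      * ((n - 1).factorial : ℝ) * ∏ j ∈ Finset.Icc 1 (n - 1), (β + (j : ℝ)))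

end

/-! Each moment is an integral `pjInt β p t` with `p = α + 1 + m`, and for non-integer `p` it splits
as `regPart β p t + t ^ p * singPart β p t` with both parts entire. To see this, expand `(1 - x) ^ β
= ∑ c_k x ^ k`, which converges absolutely up to `x = 1` because `β > 0`. After `x = 1 / y` each
term is an upper incomplete Gamma integral, namely `Γ(-(p+k)) t ^ (p+k)` minus a power series in
`t`. Summing over `k` gives the splitting for real `t > 0` (`pjInt_ofReal_eq`); the identity theorem
and a boundary limit carry it to the closed right half-plane off the cut (`pjInt_eq`).

Since `t ^ (α+1+i+j) = t ^ (α+1) * t ^ (i+j)`, the Hankel matrix is `X + t ^ (α+1) • Y` with `X`,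
`Y` entire. Multilinearity in the rows (`det_add_smul_eq_sum`) turns the determinant into a sum over
sets `s` of rows taken from `Y`, weighted by `t ^ ((α+1) |s|)`. This sum is the continuation: `s =
∅` gives `A`, singletons give `B`, and `|s| ≥ 2` gives the remainder.

The coefficients of `A` come from `regPart' β p = -regPart β (p - 1)`: differentiating the
determinant lowers one row parameter at a time. The parameters are consecutive, so most lowered
determinants have two equal rows and vanish. The survivors at `t = 0` are determinants of Beta
values, evaluated by `betaDet_eq` as Gamma factors times a Vandermonde determinant. For `B(0)` only
row `0` of `Y` survives; it leaves `Γ(-(α+1))` times a Jacobi Hankel determinant of order `n - 1`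
with `α` raised by two, and the reflection formula produces the sine.

The value `D_n(0)` is itself a Beta determinant, hence a product of Gamma values. The functional
equation `realBarnesG_add_one`, derived from the Weierstrass product, and the discrete duplication
formula `realBarnesG_duplication` rewrite it through the Barnes function. -/

noncomputable section

/-! ### The Barnes function at positive reals -/

/-- The `k`-th factor of the Weierstrass product of `G(1+w)`, for real `w`. -/
def barnesFactor (w : ℝ) (k : ℕ) : ℝ :=
  (1 + w / ((k : ℝ) + 1)) ^ (k + 1) * Real.exp (w ^ 2 / (2 * ((k : ℝ) + 1)) - w)

/-- The Barnes function on the real line. -/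
def realBarnesG (z : ℝ) : ℝ :=
  (2 * Real.pi) ^ ((z - 1) / 2)
    * Real.exp (-((z - 1) + (z - 1) ^ 2 * (1 + Real.eulerMascheroniConstant)) / 2)
    * ∏' k : ℕ, barnesFactor (z - 1) k

lemma one_add_div_pos {w : ℝ} (hw : -1 < w) (k : ℕ) : 0 < 1 + w / ((k : ℝ) + 1) := by
  have hk : (0 : ℝ) < (k : ℝ) + 1 := by positivity
  rw [show 1 + w / ((k : ℝ) + 1) = ((k : ℝ) + 1 + w) / (k + 1) by field_simp]
  have : (0 : ℝ) ≤ k := by positivity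
  apply div_pos <;> linarith

lemma barnesFactor_pos {w : ℝ} (hw : -1 < w) (k : ℕ) : 0 < barnesFactor w k :=
  mul_pos (pow_pos (one_add_div_pos hw k) _) (Real.exp_pos _)

/-- With `x = w / (k+1)` the logarithm is `(k+1) * (log (1+x) - x + x²/2)`: the exponential factor
cancels the first two Taylor terms, leaving `O(1/(k+1)²)`. -/
lemma summable_log_barnesFactor {w : ℝ} (hw : -1 < w) :
    Summable fun k => Real.log (barnesFactor w k) := by
  -- The Taylor remainder is at most `|x|³ / (1 - |x|)`, hence at most `2|x|³` once `|x| ≤ 1/2`.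
  have hs : Summable fun k : ℕ => 2 * |w| ^ 3 * (1 / ((k + 1 : ℕ) : ℝ) ^ 2) :=
    (((summable_nat_add_iff 1).2 (Real.summable_one_div_nat_pow.2 one_lt_two))).mul_left _
  refine Summable.of_norm_bounded_eventually_nat hs ?_
  obtain ⟨N, hN⟩ := exists_nat_gt (2 * |w|)
  filter_upwards [eventually_ge_atTop N] with k hk
  have hk1 : (0 : ℝ) < (k : ℝ) + 1 := by positivity
  have hkN : (N : ℝ) ≤ k := by exact_mod_cast hk
  have hx : |(-(w / ((k : ℝ) + 1)))| ≤ 1 / 2 := by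
    rw [abs_neg, abs_div, abs_of_pos hk1, div_le_iff₀ hk1]
    linarith
  have h := Real.abs_log_sub_add_sum_range_le (lt_of_le_of_lt hx (by norm_num)) 2
  have hpos := one_add_div_pos hw k
  have hlog : Real.log (barnesFactor w k) = ((k : ℝ) + 1) *
      ((∑ i ∈ Finset.range 2, (-(w / ((k : ℝ) + 1))) ^ (i + 1) / ((i : ℝ) + 1)) +
        Real.log (1 - -(w / ((k : ℝ) + 1)))) := by
    rw [barnesFactor, Real.log_mul (pow_pos hpos _).ne' (Real.exp_pos _).ne', Real.log_exp,
      Real.log_pow, sub_neg_eq_add]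
    simp only [Finset.sum_range_succ, Finset.sum_range_zero]
    push_cast
    field_simp
    ring
  rw [hlog, Real.norm_eq_abs, abs_mul, abs_of_pos hk1]
  have h2 : |(-(w / ((k : ℝ) + 1)))| ^ (2 + 1) / (1 - |(-(w / ((k : ℝ) + 1)))|) ≤
      2 * |(-(w / ((k : ℝ) + 1)))| ^ 3 := by
    rw [div_le_iff₀ (by linarith)]
    nlinarith [pow_nonneg (abs_nonneg (-(w / ((k : ℝ) + 1)))) 3]
  refine (mul_le_mul_of_nonneg_left (h.trans h2) hk1.le).trans (le_of_eq ?_)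
  rw [abs_neg, abs_div, abs_of_pos hk1]
  push_cast
  field_simp

lemma hasProd_barnesFactor {w : ℝ} (hw : -1 < w) :
    HasProd (barnesFactor w) (∏' k, barnesFactor w k) :=
  (Real.multipliable_of_summable_log (barnesFactor_pos hw) (summable_log_barnesFactor hw)).hasProd

lemma tprod_barnesFactor_pos {w : ℝ} (hw : -1 < w) : 0 < ∏' k, barnesFactor w k := by
  rw [← Real.rexp_tsum_eq_tprod (barnesFactor_pos hw) (summable_log_barnesFactor hw)]
  exact Real.exp_pos _

lemma realBarnesG_pos {z : ℝ} (hz : 0 < z) : 0 < realBarnesG z :=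
  mul_pos (mul_pos (Real.rpow_pos_of_pos (by positivity) _) (Real.exp_pos _))
    (tprod_barnesFactor_pos (by linarith))

lemma realBarnesG_one : realBarnesG 1 = 1 := by
  simp [realBarnesG, barnesFactor]

lemma barnesG_ofReal {z : ℝ} (hz : 0 < z) : barnesG (z : ℂ) = (realBarnesG z : ℂ) := by
  have h := (hasProd_barnesFactor (w := z - 1) (by linarith)).map
    (Complex.ofRealHom : ℝ →* ℂ) Complex.continuous_ofReal
  have h2 : ∏' k : ℕ, ((1 + ((z : ℂ) - 1) / ((k : ℂ) + 1)) ^ (k + 1)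
        * Complex.exp (((z : ℂ) - 1) ^ 2 / (2 * ((k : ℂ) + 1)) - ((z : ℂ) - 1))) =
      ((∏' k, barnesFactor (z - 1) k : ℝ) : ℂ) := by
    refine Eq.trans ?_ h.tprod_eq
    refine tprod_congr fun k => ?_
    simp [barnesFactor]
  rw [barnesG, h2, realBarnesG]
  push_cast [Complex.ofReal_cpow (show (0 : ℝ) ≤ 2 * Real.pi by positivity)]
  rfl

/-- The functional equation at the level of partial products; the limit of the extra factor is
`tendsto_barnes_ratio`. -/
lemma prod_barnesFactor_add_one {w : ℝ} (hw : -1 < w) (N : ℕ) :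
    (∏ k ∈ Finset.range N, barnesFactor (w + 1) k) * ∏ k ∈ Finset.range N, (w + 1 + (k : ℝ)) =
      (w + 1 + N) ^ N * Real.exp ((w + 1 / 2) * (harmonic N : ℝ) - N)
        * ∏ k ∈ Finset.range N, barnesFactor w k := by
  induction N with
  | zero => simp
  | succ N ih =>
    have hN : (0 : ℝ) < (N : ℝ) + 1 := by positivity
    have hN0 : (0 : ℝ) ≤ N := by positivity
    have hp : 0 < w + 1 + (N : ℝ) := by linarith
    rw [Finset.prod_range_succ, Finset.prod_range_succ, Finset.prod_range_succ,
      mul_mul_mul_comm, ih, harmonic_succ]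
    have key : barnesFactor (w + 1) N * (w + 1 + (N : ℝ)) * ((w + 1 + N) ^ N) =
        (w + 1 + ((N + 1 : ℕ) : ℝ)) ^ (N + 1) * Real.exp ((w + 1 / 2) * ((N : ℝ) + 1)⁻¹ - 1) *
          barnesFactor w N := by
      rw [barnesFactor, barnesFactor,
        show 1 + (w + 1) / ((N : ℝ) + 1) = (w + 1 + ((N + 1 : ℕ) : ℝ)) / (N + 1) by
          push_cast; field_simp; ring,
        show 1 + w / ((N : ℝ) + 1) = (w + 1 + (N : ℝ)) / (N + 1) by field_simp; ring,
        show (w + 1) ^ 2 / (2 * ((N : ℝ) + 1)) - (w + 1) =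
          ((w + 1 / 2) * ((N : ℝ) + 1)⁻¹ - 1) + (w ^ 2 / (2 * ((N : ℝ) + 1)) - w) by
          field_simp; ring, Real.exp_add, div_pow, div_pow]
      field_simp
      ring
    rw [show (w + 1 / 2) * (((harmonic N + (↑(N + 1))⁻¹ : ℚ)) : ℝ) - ((N + 1 : ℕ) : ℝ) =
      ((w + 1 / 2) * (harmonic N : ℝ) - N) + ((w + 1 / 2) * ((N : ℝ) + 1)⁻¹ - 1) by
        push_cast; ring, Real.exp_add]
    linear_combination (Real.exp ((w + 1 / 2) * (harmonic N : ℝ) - N)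
        * ∏ k ∈ Finset.range N, barnesFactor w k) * key

/-- The ratio is a product of four classical limits: Euler's sequence for `Γ(z)`, `(1 + z/N)^N →
e^z`, Stirling's formula, and `harmonic N - log N → γ`. The additional factor `1 + z/N` appears
because Euler's denominator contains one more term, `z + N`. -/
lemma tendsto_barnes_ratio {z : ℝ} (hz : 0 < z) :
    Tendsto (fun N : ℕ => (z + N) ^ N * Real.exp ((z - 1 / 2) * (harmonic N : ℝ) - N) /
      ∏ k ∈ Finset.range N, (z + (k : ℝ))) atTop
      (𝓝 (Real.Gamma z * (Real.exp z * 1) * (√2 * √Real.pi)⁻¹ *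
        Real.exp ((z - 1 / 2) * Real.eulerMascheroniConstant))) := by
  have h1 := Real.GammaSeq_tendsto_Gamma z
  have h2 := Real.tendsto_one_add_div_pow_exp z
  have h3 : Tendsto (fun N : ℕ => 1 + z / (N : ℝ)) atTop (𝓝 1) := by
    simpa using (tendsto_const_div_atTop_nhds_zero_nat z).const_add 1
  have h4 := ((Stirling.tendsto_stirlingSeq_sqrt_pi).const_mul √2).inv₀ (by positivity)
  have h5 := (Real.continuous_exp.tendsto _).comp
    (Real.tendsto_harmonic_sub_log.const_mul (z - 1 / 2))
  refine ((((h1.mul (h2.mul h3)).mul h4).mul h5)).congr' ?_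
  filter_upwards [eventually_ge_atTop 1] with N hN
  have hN0 : (0 : ℝ) < N := by exact_mod_cast hN
  have hprod : 0 < ∏ k ∈ Finset.range N, (z + (k : ℝ)) :=
    Finset.prod_pos fun k _ => by positivity
  have hzN : 0 < z + (N : ℝ) := by positivity
  simp only [Function.comp]
  rw [Real.GammaSeq, Stirling.stirlingSeq, Finset.prod_range_succ,
    show (z - 1 / 2) * ((harmonic N : ℝ) - Real.log N) =
      ((z - 1 / 2) * (harmonic N : ℝ) - N) + N - z * Real.log N + Real.log N / 2 by ring,
    Real.exp_add, Real.exp_sub, Real.exp_add, mul_comm z (Real.log N),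
    ← Real.rpow_def_of_pos hN0, show Real.log N / 2 = Real.log (√N) from (Real.log_sqrt hN0.le).symm,
    Real.exp_log (Real.sqrt_pos.2 hN0), Real.sqrt_mul (by norm_num), div_pow, ← Real.exp_nat_mul,
    mul_one, show 1 + z / (N : ℝ) = (z + N) / N by field_simp; ring, div_pow]
  have hr : (0 : ℝ) < (N : ℝ) ^ z := Real.rpow_pos_of_pos hN0 _
  have hs := Real.sqrt_pos.2 hN0
  have hf : (0 : ℝ) < (N.factorial : ℝ) := by positivity
  have hsN : (√(N : ℝ)) ^ 2 = N := Real.sq_sqrt hN0.le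
  field_simp
  rw [hsN]

/-- The functional equation `G(z+1) = Γ(z) G(z)`. -/
lemma realBarnesG_add_one {z : ℝ} (hz : 0 < z) :
    realBarnesG (z + 1) = Real.Gamma z * realBarnesG z := by
  have hw : -1 < z - 1 := by linarith
  have l1 := (hasProd_barnesFactor (w := z) (by linarith)).tendsto_prod_nat
  have l2 := (hasProd_barnesFactor hw).tendsto_prod_nat
  have l3 := (l2.mul (tendsto_barnes_ratio hz))
  have l4 : Tendsto (fun N : ℕ => ∏ k ∈ Finset.range N, barnesFactor z k) atTop
      (𝓝 ((∏' k, barnesFactor (z - 1) k) * (Real.Gamma z * (Real.exp z * 1) * (√2 * √Real.pi)⁻¹ *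
        Real.exp ((z - 1 / 2) * Real.eulerMascheroniConstant)))) := by
    refine l3.congr fun N => ?_
    have h := prod_barnesFactor_add_one hw N
    have hprod : 0 < ∏ k ∈ Finset.range N, (z + (k : ℝ)) :=
      Finset.prod_pos fun k _ => by positivity
    simp only [sub_add_cancel] at h
    rw [show z - 1 + 1 / 2 = z - 1 / 2 by ring] at h
    rw [← mul_div_assoc, div_eq_iff hprod.ne', h]
    ring
  have hl := tendsto_nhds_unique l1 l4
  rw [realBarnesG, realBarnesG, add_sub_cancel_right, hl,
    show z / 2 = (z - 1) / 2 + 1 / 2 by ring, Real.rpow_add (by positivity),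
    ← Real.sqrt_eq_rpow, Real.sqrt_mul (by norm_num),
    show -((z - 1) + (z - 1) ^ 2 * (1 + Real.eulerMascheroniConstant)) / 2 =
      -(z + z ^ 2 * (1 + Real.eulerMascheroniConstant)) / 2 + z +
        (z - 1 / 2) * Real.eulerMascheroniConstant by ring, Real.exp_add, Real.exp_add]
  have := Real.sqrt_pos.2 Real.pi_pos
  field_simp

lemma prod_Gamma_eq_realBarnesG_div {z : ℝ} (hz : 0 < z) (n : ℕ) :
    ∏ k ∈ Finset.range n, Real.Gamma (z + k) = realBarnesG (z + n) / realBarnesG z := by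
  have h0 := realBarnesG_pos hz
  induction n with
  | zero => simp [h0.ne']
  | succ n ih =>
    rw [Finset.prod_range_succ, ih, Nat.cast_succ, ← add_assoc,
      realBarnesG_add_one (z := z + n) (by positivity)]
    ring

/-- A discrete form of the duplication formula of the Barnes function. -/
lemma realBarnesG_duplication {s : ℝ} (hs : 0 < s) (n : ℕ) :
    realBarnesG (s + n + 1 + n) * ((4 : ℝ) ^ (-((n : ℝ) * (n + s))) * (2 * Real.pi) ^ n *
      (Real.Gamma ((s + 1) / 2) * realBarnesG ((s + 1) / 2) ^ 2 * realBarnesG (s / 2 + 1) ^ 2)) =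
    realBarnesG (s + 1) * (realBarnesG (n + (s + 1) / 2) ^ 2 * realBarnesG (n + 1 + s / 2) ^ 2 *
      Real.Gamma (n + (s + 1) / 2)) := by
  induction n with
  | zero =>
    simp only [Nat.cast_zero, zero_mul, neg_zero, Real.rpow_zero, pow_zero, zero_add, add_zero]
    rw [add_comm 1 (s / 2)]
    ring
  | succ n ih =>
    have hn : (0 : ℝ) ≤ n := by positivity
    -- In terms of `z`, the `n`-dependent Barnes arguments are integer shifts of `2z`, `z` and `z +
    -- 1/2`, so the step reduces to the square of Legendre's duplication formula (`hsq`).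
    set z : ℝ := n + (s + 1) / 2 with hzdef
    have hz : 0 < z := by positivity
    have hdup := Real.Gamma_mul_Gamma_add_half z
    have e1 : s + ((n + 1 : ℕ) : ℝ) + 1 + ((n + 1 : ℕ) : ℝ) = (2 * z + 1) + 1 := by
      rw [hzdef]; push_cast; ring
    have e2 : s + (n : ℝ) + 1 + n = 2 * z := by rw [hzdef]; ring
    have e3 : ((n + 1 : ℕ) : ℝ) + (s + 1) / 2 = z + 1 := by rw [hzdef]; push_cast; ring
    have e4 : ((n + 1 : ℕ) : ℝ) + 1 + s / 2 = (z + 1 / 2) + 1 := by rw [hzdef]; push_cast; ring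
    have e5 : (n : ℝ) + 1 + s / 2 = z + 1 / 2 := by rw [hzdef]; ring
    have e6 : (4 : ℝ) ^ (-(((n + 1 : ℕ) : ℝ) * (((n + 1 : ℕ) : ℝ) + s))) =
        (4 : ℝ) ^ (-((n : ℝ) * (n + s))) * ((2 : ℝ) ^ (1 - 2 * z)) ^ 2 / 4 := by
      rw [← Real.rpow_natCast ((2 : ℝ) ^ (1 - 2 * z)) 2, ← Real.rpow_mul (by norm_num),
        show ((2 : ℕ) : ℝ) = 2 by norm_num, mul_comm (1 - 2 * z), Real.rpow_mul (by norm_num),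
        show ((2 : ℝ) ^ (2 : ℝ)) = 4 by norm_num, ← Real.rpow_add (by norm_num),
        div_eq_mul_inv, ← Real.rpow_neg_one 4, ← Real.rpow_add (by norm_num)]
      congr 1
      rw [hzdef]; push_cast; ring
    rw [e2, e5] at ih
    rw [e1, e3, e4, e6, realBarnesG_add_one (z := 2 * z + 1) (by positivity),
      realBarnesG_add_one (z := 2 * z) (by positivity), realBarnesG_add_one hz,
      realBarnesG_add_one (z := z + 1 / 2) (by positivity),
      Real.Gamma_add_one (s := 2 * z) (by positivity), Real.Gamma_add_one hz.ne']
    have hsq : (Real.Gamma z * Real.Gamma (z + 1 / 2)) ^ 2 =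
        Real.Gamma (2 * z) ^ 2 * ((2 : ℝ) ^ (1 - 2 * z)) ^ 2 * Real.pi := by
      rw [hdup, mul_pow, mul_pow, Real.sq_sqrt Real.pi_pos.le]
    rw [pow_succ (2 * Real.pi) n]
    linear_combination (Real.Gamma (2 * z) ^ 2 * ((2 : ℝ) ^ (1 - 2 * z)) ^ 2 * Real.pi * z) * ih -
      (realBarnesG (s + 1) * realBarnesG z ^ 2 * realBarnesG (z + 1 / 2) ^ 2 * Real.Gamma z * z)
        * hsq

/-- The value of the Hankel determinant of the Jacobi weight as a product of Gamma values. -/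
def jacobiHankel (n : ℕ) (α β : ℝ) : ℝ :=
  ∏ k ∈ Finset.range n, ((k.factorial : ℝ) * Real.Gamma (α + 1 + k) * Real.Gamma (β + 1 + k) /
    Real.Gamma (α + β + n + 1 + k))

lemma jacobiHankel_eq_barnesG (n : ℕ) {α β : ℝ} (hα : 0 < α) (hβ : 0 < β) :
    (jacobiHankel n α β : ℂ) =
      (4 : ℂ) ^ (-((n : ℂ) * (n + α + β))) * (2 * (Real.pi : ℂ)) ^ n
        * (Complex.Gamma ((α + β + 1) / 2) * barnesG ((α + β + 1) / 2) ^ 2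
            * barnesG ((α + β) / 2 + 1) ^ 2
          / (barnesG (α + β + 1) * barnesG (α + 1) * barnesG (β + 1)))
        * (barnesG (n + 1) * barnesG (n + α + 1) * barnesG (n + β + 1) * barnesG (n + α + β + 1)
          / (barnesG (n + (α + β + 1) / 2) ^ 2 * barnesG (n + 1 + (α + β) / 2) ^ 2
            * Complex.Gamma (n + (α + β + 1) / 2))) := by
  have hn : (0 : ℝ) ≤ n := by positivity
  have key : jacobiHankel n α β =
      (4 : ℝ) ^ (-((n : ℝ) * (n + α + β))) * (2 * Real.pi) ^ n
        * (Real.Gamma ((α + β + 1) / 2) * realBarnesG ((α + β + 1) / 2) ^ 2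
            * realBarnesG ((α + β) / 2 + 1) ^ 2
          / (realBarnesG (α + β + 1) * realBarnesG (α + 1) * realBarnesG (β + 1)))
        * (realBarnesG (n + 1) * realBarnesG (n + α + 1) * realBarnesG (n + β + 1)
          * realBarnesG (n + α + β + 1)
          / (realBarnesG (n + (α + β + 1) / 2) ^ 2 * realBarnesG (n + 1 + (α + β) / 2) ^ 2
            * Real.Gamma (n + (α + β + 1) / 2))) := by
    have hfac : ∏ k ∈ Finset.range n, (k.factorial : ℝ) = realBarnesG (n + 1) := by
      have := prod_Gamma_eq_realBarnesG_div one_pos n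
      rw [realBarnesG_one, div_one] at this
      rw [add_comm (n : ℝ), ← this]
      refine Finset.prod_congr rfl fun k _ => ?_
      rw [add_comm, Real.Gamma_nat_eq_factorial]
    have hd := realBarnesG_duplication (s := α + β) (by positivity) n
    rw [jacobiHankel, Finset.prod_div_distrib, Finset.prod_mul_distrib, Finset.prod_mul_distrib,
      hfac, prod_Gamma_eq_realBarnesG_div (by positivity), prod_Gamma_eq_realBarnesG_div (by positivity),
      prod_Gamma_eq_realBarnesG_div (by positivity), add_comm (α + 1), add_comm (β + 1),
      ← add_assoc, ← add_assoc, show (n : ℝ) + α + β + 1 = α + β + n + 1 by ring,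
      show (n : ℝ) + α + β = n + (α + β) by ring]
    have p1 := realBarnesG_pos (z := α + β + n + 1 + n) (by positivity)
    have p2 := realBarnesG_pos (z := α + β + n + 1) (by positivity)
    have p3 := realBarnesG_pos (z := α + β + 1) (by positivity)
    have p4 := realBarnesG_pos (z := α + 1) (by positivity)
    have p5 := realBarnesG_pos (z := β + 1) (by positivity)
    have p6 := realBarnesG_pos (z := n + (α + β + 1) / 2) (by positivity)
    have p7 := realBarnesG_pos (z := n + 1 + (α + β) / 2) (by positivity)
    have p8 := Real.Gamma_pos_of_pos (s := n + (α + β + 1) / 2) (by positivity)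
    generalize realBarnesG (α + β + n + 1 + n) = x1 at *
    generalize realBarnesG (α + β + n + 1) = x2 at *
    generalize realBarnesG (α + β + 1) = x3 at *
    generalize realBarnesG (α + 1) = x4 at *
    generalize realBarnesG (β + 1) = x5 at *
    generalize realBarnesG (n + (α + β + 1) / 2) = x6 at *
    generalize realBarnesG (n + 1 + (α + β) / 2) = x7 at *
    generalize Real.Gamma (n + (α + β + 1) / 2) = x8 at *
    generalize (4 : ℝ) ^ (-((n : ℝ) * (n + (α + β)))) = x9 at *
    generalize realBarnesG ((α + β + 1) / 2) = x10 at *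
    generalize realBarnesG ((α + β) / 2 + 1) = x11 at *
    generalize Real.Gamma ((α + β + 1) / 2) = x12 at *
    field_simp
    linear_combination
      (-(realBarnesG (n + 1) * realBarnesG (n + α + 1) * realBarnesG (n + β + 1))) * hd
  have c1 := barnesG_ofReal (z := n + 1) (by positivity)
  have c2 := barnesG_ofReal (z := α + β + 1) (by positivity)
  have c3 := barnesG_ofReal (z := α + 1) (by positivity)
  have c4 := barnesG_ofReal (z := β + 1) (by positivity)
  have c5 := barnesG_ofReal (z := (α + β + 1) / 2) (by positivity)
  have c6 := barnesG_ofReal (z := (α + β) / 2 + 1) (by positivity)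
  have c7 := barnesG_ofReal (z := n + α + 1) (by positivity)
  have c8 := barnesG_ofReal (z := n + β + 1) (by positivity)
  have c9 := barnesG_ofReal (z := n + α + β + 1) (by positivity)
  have c10 := barnesG_ofReal (z := n + (α + β + 1) / 2) (by positivity)
  have c11 := barnesG_ofReal (z := n + 1 + (α + β) / 2) (by positivity)
  have g1 := Complex.Gamma_ofReal ((α + β + 1) / 2)
  have g2 := Complex.Gamma_ofReal (n + (α + β + 1) / 2)
  push_cast at c1 c2 c3 c4 c5 c6 c7 c8 c9 c10 c11 g1 g2
  rw [key, c1, c2, c3, c4, c5, c6, c7, c8, c9, c10, c11, g1, g2]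
  push_cast [Complex.ofReal_cpow (show (0 : ℝ) ≤ 4 by norm_num)]
  rfl

/-! ### Determinants of Beta values -/

lemma det_eval_eq_vandermonde_mul {R : Type*} [CommRing R] {n : ℕ} (v : Fin n → R)
    (p : Fin n → Polynomial R) (hp : ∀ j, (p j).natDegree < n) :
    (Matrix.of fun i j => (p j).eval (v i)).det =
      (Matrix.vandermonde v).det * (Matrix.of fun i j : Fin n => (p j).coeff i).det := by
  rw [← Matrix.det_mul]
  congr 1
  ext i j
  rw [Matrix.mul_apply, Matrix.of_apply, Polynomial.eval_eq_sum_range' (hp j),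
    ← Fin.sum_univ_eq_sum_range (fun k => (p j).coeff k * v i ^ k)]
  exact Finset.sum_congr rfl fun k _ => by simp [Matrix.vandermonde, mul_comm]

/-- The coefficient determinant does not depend on `v`, so it can be computed at `v i = -i`. There
the rising factorial of order `j` vanishes for `i < j`, and the matrix is triangular. The diagonal
factors `(-i)_i` multiply to the Vandermonde determinant, which cancels. -/
lemma det_ascPochhammer_mul (n : ℕ) (c : ℝ) (v : Fin n → ℝ) :
    (Matrix.of fun i j : Fin n => (ascPochhammer ℝ j).eval (v i) *
      (ascPochhammer ℝ (n - 1 - j)).eval (v i + (c + j))).det =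
    (Matrix.vandermonde v).det * ∏ k ∈ Finset.range n, (ascPochhammer ℝ k).eval c := by
  set p : Fin n → Polynomial ℝ := fun j => ascPochhammer ℝ j *
    (ascPochhammer ℝ (n - 1 - j)).comp (Polynomial.X + Polynomial.C (c + j)) with hp
  have heval : ∀ (x : ℝ) j, (p j).eval x = (ascPochhammer ℝ j).eval x *
      (ascPochhammer ℝ (n - 1 - j)).eval (x + (c + j)) := fun x j => by simp [hp]
  have hdeg : ∀ j, (p j).natDegree < n := fun j => by
    have h1 : (p j).natDegree ≤ j + (n - 1 - j) := by
      refine Polynomial.natDegree_mul_le.trans ?_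
      rw [Polynomial.natDegree_comp, Polynomial.natDegree_X_add_C, ascPochhammer_natDegree,
        ascPochhammer_natDegree, mul_one]
    have := j.2
    omega
  simp_rw [← heval]
  rw [det_eval_eq_vandermonde_mul v p hdeg]
  congr 1
  have hu := det_eval_eq_vandermonde_mul (fun i : Fin n => -((i : ℕ) : ℝ)) p hdeg
  have hu2 := (Matrix.det_eval_matrixOfPolynomials_eq_det_vandermonde
    (fun i : Fin n => -((i : ℕ) : ℝ)) (fun j => ascPochhammer ℝ j)
    (fun i => ascPochhammer_natDegree _ _) (fun i => monic_ascPochhammer _ _)).symm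
  have hvan : (Matrix.vandermonde fun i : Fin n => -((i : ℕ) : ℝ)).det ≠ 0 :=
    Matrix.det_vandermonde_ne_zero_iff.2 fun i j h => by
      simpa [Fin.ext_iff] using h
  have hzero : ∀ i j : Fin n, i < j → (ascPochhammer ℝ j).eval (-((i : ℕ) : ℝ)) = 0 :=
    fun i j hij => ascPochhammer_eval_neg_coe_nat_of_lt hij
  have htri : (Matrix.of fun i j : Fin n =>
      (ascPochhammer ℝ j).eval (-((i : ℕ) : ℝ))).IsLowerTriangular := fun i j hij => hzero i j hij
  rw [Matrix.det_of_isLowerTriangular _ htri] at hu2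
  rw [Matrix.det_of_isLowerTriangular _ (fun i j hij => by
    simp only [Matrix.of_apply, heval]; rw [hzero i j hij, zero_mul])] at hu
  simp only [Matrix.of_apply, heval, Finset.prod_mul_distrib] at hu hu2
  rw [hu2] at hu
  rw [← mul_left_cancel₀ hvan hu]
  have : ∀ i : Fin n, (ascPochhammer ℝ (n - 1 - i)).eval (-((i : ℕ) : ℝ) + (c + (i : ℕ))) =
      (ascPochhammer ℝ (n - 1 - i)).eval c := fun i => by congr 1; ring
  simp_rw [this]
  rw [Fin.prod_univ_eq_prod_range (fun i => (ascPochhammer ℝ (n - 1 - i)).eval c),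
    Finset.prod_range_reflect (fun i => (ascPochhammer ℝ i).eval c)]

lemma Real.Gamma_add_nat_eq {a : ℝ} (j : ℕ) (ha : ∀ m : ℕ, a + m ≠ 0) :
    Real.Gamma (a + j) = (ascPochhammer ℝ j).eval a * Real.Gamma a := by
  induction j with
  | zero => simp
  | succ j ih =>
    rw [Nat.cast_succ, ← add_assoc, Real.Gamma_add_one (ha j), ih, ascPochhammer_succ_eval]
    ring

/-- `Γ(a)Γ(c)/Γ(a+c)`, the value of the Beta function continued in `a`. -/
def gammaBeta (a c : ℝ) : ℝ := Real.Gamma a * Real.Gamma c / Real.Gamma (a + c)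

/-- The determinant of the matrix `B(a_i + j, c)`. -/
def betaDet (n : ℕ) (c : ℝ) (a : Fin n → ℝ) : ℝ :=
  (Matrix.of fun i j : Fin n => gammaBeta (a i + (j : ℕ)) c).det

/-- Extending the denominator to `Γ(a_i + c + n - 1)` makes it independent of the column. The row
factors then come out, leaving the polynomial entries `(a_i)_j (a_i + c + j)_{n-1-j}` of
`det_ascPochhammer_mul`. -/
lemma betaDet_eq {n : ℕ} {c : ℝ} {a : Fin n → ℝ} (ha : ∀ i, ∀ m : ℕ, a i + m ≠ 0)
    (hac : ∀ i, 0 < a i + c) :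
    betaDet n c a = (∏ i, (Real.Gamma (a i) * Real.Gamma c / Real.Gamma (a i + c + (n - 1 : ℕ)))) *
      ((Matrix.vandermonde a).det * ∏ k ∈ Finset.range n, (ascPochhammer ℝ k).eval c) := by
  rw [← det_ascPochhammer_mul, ← Matrix.det_mul_column, betaDet]
  congr 1
  ext i j
  simp only [Matrix.of_apply, gammaBeta]
  have hj : ((j : ℕ) : ℝ) + ((n - 1 - j : ℕ) : ℝ) = ((n - 1 : ℕ) : ℝ) := by
    have := j.2
    norm_cast
    omega
  have hpos : 0 < a i + c + (j : ℕ) := add_pos_of_pos_of_nonneg (hac i) (by positivity)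
  have h2 := Real.Gamma_add_nat_eq (a := a i + c + (j : ℕ)) (n - 1 - j)
    (fun m => (add_pos_of_pos_of_nonneg hpos (by positivity)).ne')
  rw [add_assoc (a i + c), hj] at h2
  rw [Real.Gamma_add_nat_eq j (ha i), h2,
    show a i + (j : ℕ) + c = a i + c + (j : ℕ) by ring, ← add_assoc]
  have h3 := (Real.Gamma_pos_of_pos hpos).ne'
  have h4 := (ascPochhammer_pos (n - 1 - j) _ hpos).ne'
  rw [mul_comm (Polynomial.eval (a i + c + (j : ℕ)) _)]
  field_simp

lemma det_vandermonde_cons {n : ℕ} (x : ℝ) (v : Fin n → ℝ) :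
    (Matrix.vandermonde (Fin.cons x v : Fin (n + 1) → ℝ)).det =
      (∏ j, (v j - x)) * (Matrix.vandermonde v).det := by
  rw [Matrix.det_vandermonde, Matrix.det_vandermonde, Fin.prod_univ_succ]
  simp only [Fin.prod_Ioi_zero, Fin.prod_Ioi_succ, Fin.cons_zero, Fin.cons_succ]

lemma prod_fin_add_one (n : ℕ) : ∏ j : Fin n, (((j : ℕ) : ℝ) + 1) = n.factorial := by
  rw [Fin.prod_univ_eq_prod_range (fun j => (j : ℝ) + 1)]
  exact_mod_cast Finset.prod_range_add_one_eq_factorial n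

lemma prod_fin_add_two (n : ℕ) :
    ∏ j : Fin n, (((j : ℕ) : ℝ) + 2) = (n.factorial : ℝ) * (n + 1) := by
  induction n with
  | zero => simp
  | succ n ih =>
    rw [Fin.prod_univ_castSucc]
    simp only [Fin.val_castSucc, ih, Fin.val_last, Nat.factorial_succ]
    push_cast
    ring

lemma prod_fin_add_three (n : ℕ) :
    ∏ j : Fin n, (((j : ℕ) : ℝ) + 3) = (n.factorial : ℝ) * (n + 1) * (n + 2) / 2 := by
  induction n with
  | zero => simp
  | succ n ih =>
    rw [Fin.prod_univ_castSucc]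
    simp only [Fin.val_castSucc, ih, Fin.val_last, Nat.factorial_succ]
    push_cast
    ring

lemma betaDet_jacobi (n : ℕ) {α β : ℝ} (hα : 0 < α) (hβ : 0 < β) :
    betaDet n (β + 1) (fun i => α + 1 + (i : ℕ)) = jacobiHankel n α β := by
  rw [betaDet_eq (fun i m => by positivity) (fun i => by positivity), jacobiHankel]
  have hv : (Matrix.vandermonde fun i : Fin n => α + 1 + ((i : ℕ) : ℝ)).det =
      ∏ k ∈ Finset.range n, (k.factorial : ℝ) := by
    have h1 : (fun i : Fin n => α + 1 + ((i : ℕ) : ℝ)) = fun i : Fin n => ((i : ℕ) : ℝ) + (α + 1) :=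
      funext fun i => add_comm _ _
    rw [h1, Matrix.det_vandermonde_add]
    rcases n with _ | n
    · simp
    · rw [Matrix.det_vandermonde_id_eq_superFactorial]
      induction n with
      | zero => simp
      | succ n ih =>
        rw [Finset.prod_range_succ, ← ih, Nat.superFactorial_succ]
        · push_cast; ring
        · exact funext fun i => add_comm _ _
  rw [hv, Fin.prod_univ_eq_prod_range (fun i => Real.Gamma (α + 1 + (i : ℝ)) *
    Real.Gamma (β + 1) / Real.Gamma (α + 1 + (i : ℝ) + (β + 1) + (n - 1 : ℕ))),
    ← Finset.prod_mul_distrib, ← Finset.prod_mul_distrib]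
  refine Finset.prod_congr rfl fun k hk => ?_
  rw [Real.Gamma_add_nat_eq (a := β + 1) k (fun m => by positivity)]
  have hn : 1 ≤ n := by have := Finset.mem_range.1 hk; omega
  rw [Nat.cast_sub hn, show α + 1 + (k : ℝ) + (β + 1) + ((n : ℝ) - (1 : ℕ)) =
    α + β + n + 1 + k by push_cast; ring]
  ring

/-- Isolates the dependence on the first parameter: determinants that differ only in `x` share the
last factor, so their quotient is elementary. -/
lemma betaDet_cons {n : ℕ} {c x : ℝ} {v : Fin n → ℝ} (hx : ∀ m : ℕ, x + m ≠ 0)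
    (hxc : 0 < x + c) (hv : ∀ i, ∀ m : ℕ, v i + m ≠ 0) (hvc : ∀ i, 0 < v i + c) :
    betaDet (n + 1) c (Fin.cons x v) =
      Real.Gamma x / Real.Gamma (x + c + n) * (∏ j, (v j - x)) *
      (Real.Gamma c *
        (∏ i, (Real.Gamma (v i) * Real.Gamma c / Real.Gamma (v i + c + n))) *
        ((Matrix.vandermonde v).det * ∏ k ∈ Finset.range (n + 1), (ascPochhammer ℝ k).eval c)) := by
  rw [betaDet_eq (Fin.cases hx hv) (Fin.cases hxc hvc), Fin.prod_univ_succ, det_vandermonde_cons]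
  simp only [Fin.cons_zero, Fin.cons_succ, Nat.add_sub_cancel]
  ring

lemma cons_param_eq (n : ℕ) (α : ℝ) :
    (Fin.cons (α + 1) fun i : Fin n => α + 1 + 1 + ((i : ℕ) : ℝ) : Fin (n + 1) → ℝ) =
      fun i : Fin (n + 1) => α + 1 + ((i : ℕ) : ℝ) := by
  ext i
  refine Fin.cases ?_ (fun i => ?_) i
  · simp
  · simp; ring

/-! ### Quotients of Beta determinants under parameter shifts -/

section ratios

variable {α β : ℝ}

/-- Lowering the first index once. -/
lemma betaDet_lower_one (n : ℕ) (hα : 0 < α) (hβ : 0 < β) :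
    betaDet (n + 1) (β + 1) (Fin.cons α fun i : Fin n => α + 1 + 1 + (i : ℕ)) =
      jacobiHankel (n + 1) α β * ((n + 1) * (n + 1 + α + β) / α) := by
  rw [← betaDet_jacobi (n + 1) hα hβ, ← cons_param_eq,
    betaDet_cons (fun m => by positivity) (by positivity) (fun i m => by positivity)
      (fun i => by positivity),
    betaDet_cons (fun m => by positivity) (by positivity) (fun i m => by positivity)
      (fun i => by positivity)]
  have e1 : ∀ j : Fin n, α + 1 + 1 + ((j : ℕ) : ℝ) - α = (j : ℕ) + 2 := fun j => by ring
  have e2 : ∀ j : Fin n, α + 1 + 1 + ((j : ℕ) : ℝ) - (α + 1) = (j : ℕ) + 1 := fun j => by ring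
  simp_rw [e1, e2]
  rw [prod_fin_add_one, prod_fin_add_two, Real.Gamma_add_one hα.ne',
    show α + 1 + (β + 1) + (n : ℝ) = α + (β + 1) + n + 1 by ring,
    Real.Gamma_add_one (s := α + (β + 1) + n) (by positivity)]
  have := (Real.Gamma_pos_of_pos (s := α + (β + 1) + n) (by positivity)).ne'
  field_simp
  ring

/-- Lowering the first index twice. -/
lemma betaDet_lower_two (n : ℕ) (hα : 0 < α) (hβ : 0 < β) (hα' : ∀ m : ℤ, α ≠ m) :
    betaDet (n + 1) (β + 1) (Fin.cons (α - 1) fun i : Fin n => α + 1 + 1 + (i : ℕ)) =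
      jacobiHankel (n + 1) α β * ((n + 1) * (n + 2) * (n + 1 + α + β) * (n + α + β) /
        (2 * α * (α - 1))) := by
  have hα1 : α - 1 ≠ 0 := by
    have := hα' 1
    push_cast at this
    exact sub_ne_zero.2 this
  -- The parameter `α - 1` may be negative: poles are excluded by non-integrality, while `(α - 1) +
  -- (β + 1) = α + β` stays positive.
  rw [← betaDet_jacobi (n + 1) hα hβ, ← cons_param_eq,
    betaDet_cons (fun m h => hα' (1 - m) (by push_cast; linarith)) (by linarith)
      (fun i m => by positivity) (fun i => by positivity),
    betaDet_cons (fun m => by positivity) (by positivity) (fun i m => by positivity)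
      (fun i => by positivity)]
  have e1 : ∀ j : Fin n, α + 1 + 1 + ((j : ℕ) : ℝ) - (α - 1) = (j : ℕ) + 3 := fun j => by ring
  have e2 : ∀ j : Fin n, α + 1 + 1 + ((j : ℕ) : ℝ) - (α + 1) = (j : ℕ) + 1 := fun j => by ring
  simp_rw [e1, e2]
  have hx : 0 < α - 1 + (β + 1) + n := by
    have : (0 : ℝ) ≤ n := by positivity
    linarith
  rw [prod_fin_add_one, prod_fin_add_three, Real.Gamma_add_one hα.ne',
    show Real.Gamma α = Real.Gamma (α - 1 + 1) by ring_nf, Real.Gamma_add_one hα1,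
    show α + 1 + (β + 1) + (n : ℝ) = α - 1 + (β + 1) + n + 1 + 1 by ring,
    Real.Gamma_add_one (s := α - 1 + (β + 1) + n + 1) (by positivity),
    Real.Gamma_add_one (s := α - 1 + (β + 1) + n) hx.ne']
  have := (Real.Gamma_pos_of_pos hx).ne'
  rw [show α - 1 + (β + 1) + n = n + α + β by ring] at *
  field_simp
  ring

/-- Lowering the first two indices. -/
lemma betaDet_lower_one_one (n : ℕ) (hα : 0 < α) (hβ : 0 < β) :
    betaDet (n + 1 + 1) (β + 1)
        (Fin.cons α (Fin.cons (α + 1) fun i : Fin n => α + 1 + 2 + (i : ℕ))) =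
      jacobiHankel (n + 1 + 1) α β * ((n + 2) * (n + 1) * (n + 2 + α + β) * (n + 3 + α + β) /
        (2 * α * (α + 1))) := by
  have h0 : (fun i : Fin (n + 1 + 1) => α + 1 + ((i : ℕ) : ℝ)) =
      Fin.cons (α + 1) (Fin.cons (α + 1 + 1) fun i : Fin n => α + 1 + 2 + ((i : ℕ) : ℝ)) := by
    ext i
    refine Fin.cases ?_ (fun i => Fin.cases ?_ (fun i => ?_) i) i
    · simp
    · simp
    · simp; ring
  have hp : ∀ x : ℝ, 0 < x → ∀ i, 0 < (Fin.cons x fun i : Fin n => α + 1 + 2 + ((i : ℕ) : ℝ) :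
      Fin (n + 1) → ℝ) i := fun x hx => Fin.cases hx fun i => by
    simp only [Fin.cons_succ]; positivity
  have hq : ∀ x : ℝ, 0 < x → ∀ i, ∀ m : ℕ, (Fin.cons x fun i : Fin n => α + 1 + 2 +
      ((i : ℕ) : ℝ) : Fin (n + 1) → ℝ) i + m ≠ 0 := fun x hx i m =>
    (add_pos_of_pos_of_nonneg (hp x hx i) (by positivity)).ne'
  have hr : ∀ x : ℝ, 0 < x → ∀ i, 0 < (Fin.cons x fun i : Fin n => α + 1 + 2 +
      ((i : ℕ) : ℝ) : Fin (n + 1) → ℝ) i + (β + 1) := fun x hx i =>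
    (add_pos (hp x hx i) (by positivity))
  rw [← betaDet_jacobi (n + 1 + 1) hα hβ, h0,
    betaDet_cons (fun m => by positivity) (by positivity) (hq _ (by positivity))
      (hr _ (by positivity)),
    betaDet_cons (fun m => by positivity) (by positivity) (hq _ (by positivity))
      (hr _ (by positivity)), det_vandermonde_cons, det_vandermonde_cons]
  simp only [Fin.prod_univ_succ, Fin.cons_zero, Fin.cons_succ]
  have e1 : ∀ j : Fin n, α + 1 + 2 + ((j : ℕ) : ℝ) - α = (j : ℕ) + 3 := fun j => by ring
  have e2 : ∀ j : Fin n, α + 1 + 2 + ((j : ℕ) : ℝ) - (α + 1) = (j : ℕ) + 2 := fun j => by ring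
  have e3 : ∀ j : Fin n, α + 1 + 2 + ((j : ℕ) : ℝ) - (α + 1 + 1) = (j : ℕ) + 1 := fun j => by ring
  simp_rw [e1, e2, e3]
  have hn : (0 : ℝ) ≤ n := by positivity
  have hx : 0 < α + (β + 1) + (n + 1 : ℕ) := by positivity
  rw [prod_fin_add_one, prod_fin_add_two, prod_fin_add_three,
    Real.Gamma_add_one (s := α + 1) (by positivity), Real.Gamma_add_one hα.ne',
    show α + 1 + 1 + (β + 1) + ((n + 1 : ℕ) : ℝ) = α + (β + 1) + (n + 1 : ℕ) + 1 + 1 by ring,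
    show α + 1 + (β + 1) + ((n + 1 : ℕ) : ℝ) = α + (β + 1) + (n + 1 : ℕ) + 1 by ring,
    Real.Gamma_add_one (s := α + (β + 1) + (n + 1 : ℕ) + 1) (by positivity),
    Real.Gamma_add_one hx.ne']
  have := (Real.Gamma_pos_of_pos hx).ne'
  rw [show α + (β + 1) + ((n + 1 : ℕ) : ℝ) = n + 2 + α + β by push_cast; ring] at *
  field_simp
  ring

lemma jacobiHankel_pos (n : ℕ) (hα : 0 < α) (hβ : 0 < β) : 0 < jacobiHankel n α β :=
  Finset.prod_pos fun k _ => div_pos (mul_pos (mul_pos (by positivity)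
    (Real.Gamma_pos_of_pos (by positivity))) (Real.Gamma_pos_of_pos (by positivity)))
    (Real.Gamma_pos_of_pos (by positivity))

lemma prod_Gamma_add_one_eq {x : ℝ} (n : ℕ) :
    Real.Gamma x * ∏ k ∈ Finset.range n, Real.Gamma (x + 1 + k) =
      (∏ k ∈ Finset.range n, Real.Gamma (x + k)) * Real.Gamma (x + n) := by
  have h := (Finset.prod_range_succ (fun k : ℕ => Real.Gamma (x + k)) n).symm.trans
    (Finset.prod_range_succ' (fun k : ℕ => Real.Gamma (x + k)) n)
  rw [h]
  simp only [Nat.cast_succ, Nat.cast_zero, add_zero, mul_comm]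
  congr 1
  exact Finset.prod_congr rfl fun k _ => by ring_nf

/-- Quotient of the Hankel determinants of order `n` and `n + 1`, with `α` raised by two. -/
lemma jacobiHankel_raise_two (n : ℕ) (hα : 0 < α) (hβ : 0 < β) :
    jacobiHankel n (α + 2) β = jacobiHankel (n + 1) α β *
      (Real.Gamma (α + n + 2) * Real.Gamma (α + β + n + 2) /
        (n.factorial * Real.Gamma (β + 1 + n) * Real.Gamma (α + 1) * Real.Gamma (α + 2))) := by
  simp only [jacobiHankel, Finset.prod_div_distrib, Finset.prod_mul_distrib]
  have h1 := prod_Gamma_add_one_eq (x := α + 1) (n + 1)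
  have h2 := prod_Gamma_add_one_eq (x := α + β + n + 2) n
  have h3 := Finset.prod_range_succ' (fun k : ℕ => Real.Gamma (α + 2 + k)) n
  have e1 : ∀ k : ℕ, α + 2 + 1 + (k : ℝ) = α + 2 + ((k + 1 : ℕ) : ℝ) := fun k => by
    push_cast; ring
  have e2 : ∀ k : ℕ, α + 2 + β + n + 1 + (k : ℝ) = α + β + n + 2 + 1 + k := fun k => by ring
  have e3 : ∀ k : ℕ, α + β + (n + 1 : ℕ) + 1 + (k : ℝ) = α + β + n + 2 + k := fun k => by
    push_cast; ring
  simp_rw [e1, e2, e3]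
  simp only [show α + 1 + 1 = α + 2 by ring, show α + 1 + ((n + 1 : ℕ) : ℝ) = α + n + 2 by
    push_cast; ring] at h1
  simp only [Nat.cast_zero, add_zero] at h3
  rw [Finset.prod_range_succ (fun k : ℕ => (k.factorial : ℝ)),
    Finset.prod_range_succ (fun k : ℕ => Real.Gamma (β + 1 + k)),
    Finset.prod_range_succ (fun k : ℕ => Real.Gamma (α + β + n + 2 + k))]
  rw [h3] at h1
  have p1 : ∏ k ∈ Finset.range n, Real.Gamma (α + β + n + 2 + k) ≠ 0 :=
    (Finset.prod_pos fun k _ => Real.Gamma_pos_of_pos (by positivity)).ne'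
  have p2 : ∏ k ∈ Finset.range n, Real.Gamma (α + β + n + 2 + 1 + k) ≠ 0 :=
    (Finset.prod_pos fun k _ => Real.Gamma_pos_of_pos (by positivity)).ne'
  have p3 := (Real.Gamma_pos_of_pos (s := β + 1 + n) (by positivity)).ne'
  have p4 := (Real.Gamma_pos_of_pos (s := α + 1) (by positivity)).ne'
  have p5 := (Real.Gamma_pos_of_pos (s := α + 2) (by positivity)).ne'
  have p6 := (Real.Gamma_pos_of_pos (s := α + β + n + 2 + n) (by positivity)).ne'
  have p7 : (n.factorial : ℝ) ≠ 0 := by positivity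
  generalize ∏ k ∈ Finset.range n, Real.Gamma (α + β + n + 2 + k) = y1 at *
  generalize ∏ k ∈ Finset.range n, Real.Gamma (α + β + n + 2 + 1 + k) = y2 at *
  generalize ∏ k ∈ Finset.range n, Real.Gamma (α + 2 + ((k + 1 : ℕ) : ℝ)) = y3 at *
  generalize ∏ k ∈ Finset.range (n + 1), Real.Gamma (α + 1 + k) = y4 at *
  generalize ∏ k ∈ Finset.range n, Real.Gamma (β + 1 + k) = y5 at *
  generalize ∏ k ∈ Finset.range n, (k.factorial : ℝ) = y6 at *
  generalize Real.Gamma (α + β + n + 2 + n) = y7 at *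
  generalize Real.Gamma (α + β + n + 2) = y8 at *
  generalize Real.Gamma (β + 1 + n) = y9 at *
  generalize Real.Gamma (α + n + 2) = y10 at *
  generalize Real.Gamma (α + 1) = y11 at *
  generalize Real.Gamma (α + 2) = y12 at *
  field_simp
  linear_combination (y6 * y5 * y1 * y7) * h1 - (y6 * y5 * y4 * y10) * h2

end ratios

/-! ### Exponential generating functions with bounded coefficients -/

/-- The exponential generating function `∑ a_k t^k / k!`. -/
def egf (a : ℕ → ℂ) (t : ℂ) : ℂ := ∑' k : ℕ, a k * t ^ k / (k.factorial : ℂ)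

lemma norm_egf_term_le {a : ℕ → ℂ} {C : ℝ} (ha : ∀ k, ‖a k‖ ≤ C) (t : ℂ) (k : ℕ) :
    ‖a k * t ^ k / (k.factorial : ℂ)‖ ≤ C * (‖t‖ ^ k / k.factorial) := by
  rw [norm_div, norm_mul, norm_pow, Complex.norm_natCast, mul_div_assoc]
  exact mul_le_mul_of_nonneg_right (ha k) (by positivity)

lemma summable_egf {a : ℕ → ℂ} {C : ℝ} (ha : ∀ k, ‖a k‖ ≤ C) (t : ℂ) :
    Summable fun k : ℕ => a k * t ^ k / (k.factorial : ℂ) :=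
  Summable.of_norm_bounded ((Real.summable_pow_div_factorial ‖t‖).mul_left C)
    (norm_egf_term_le ha t)

lemma egf_zero (a : ℕ → ℂ) : egf a 0 = a 0 := by
  rw [egf, tsum_eq_single 0 fun k hk => by simp [hk]]
  simp

/-- Termwise differentiation, dominated on the ball of radius `‖t‖ + 1`, shifts the coefficient
sequence. -/
lemma hasDerivAt_egf {a : ℕ → ℂ} {C : ℝ} (ha : ∀ k, ‖a k‖ ≤ C) (t : ℂ) :
    HasDerivAt (egf a) (egf (fun k => a (k + 1)) t) t := by
  have hC : 0 ≤ C := (norm_nonneg _).trans (ha 0)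
  set R := ‖t‖ + 1 with hR
  have hR0 : 0 ≤ R := by positivity
  have hu : Summable fun k : ℕ => C * (k * R ^ (k - 1) / k.factorial) := by
    refine Summable.mul_left C ((summable_nat_add_iff 1).1 ?_)
    refine (Real.summable_pow_div_factorial R).congr fun k => ?_
    rw [Nat.factorial_succ, Nat.add_sub_cancel]
    push_cast
    field_simp
  have hbd : ∀ (n : ℕ) (y : ℂ), y ∈ Metric.ball (0 : ℂ) R →
      ‖a n * (n * y ^ (n - 1)) / (n.factorial : ℂ)‖ ≤ C * (n * R ^ (n - 1) / n.factorial) := by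
    intro n y hy
    rw [norm_div, norm_mul, norm_mul, norm_pow, Complex.norm_natCast, Complex.norm_natCast,
      mul_div_assoc]
    have hy' : ‖y‖ ≤ R := by simpa using (Metric.mem_ball.1 hy).le
    have := ha n
    gcongr
  have ht : t ∈ Metric.ball (0 : ℂ) R := by simp [hR]
  have h := hasDerivAt_tsum_of_isPreconnected hu Metric.isOpen_ball
    (convex_ball (0 : ℂ) R).isPreconnected
    (fun n y _ => ((hasDerivAt_pow n y).const_mul (a n)).div_const (n.factorial : ℂ)) hbd ht
    (summable_egf ha t) ht
  have hs : Summable fun n : ℕ => a n * (n * t ^ (n - 1)) / (n.factorial : ℂ) :=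
    Summable.of_norm_bounded hu fun n => hbd n t ht
  rw [hs.tsum_eq_zero_add] at h
  refine (show HasDerivAt (egf a) _ t from h).congr_deriv ?_
  rw [egf]
  simp only [Nat.cast_zero, zero_mul, mul_zero, zero_div, zero_add, Nat.add_sub_cancel]
  refine tsum_congr fun k => ?_
  rw [Nat.factorial_succ]
  push_cast
  have : ((k : ℂ) + 1) ≠ 0 := Nat.cast_add_one_ne_zero k
  field_simp

lemma differentiable_egf {a : ℕ → ℂ} {C : ℝ} (ha : ∀ k, ‖a k‖ ≤ C) : Differentiable ℂ (egf a) :=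
  fun t => (hasDerivAt_egf ha t).differentiableAt

/-! ### The binomial series of `(1 - x)^β` -/

/-- The coefficients of the expansion of `(1 - x)^β`. -/
def binomC (β : ℝ) (k : ℕ) : ℝ := (-1) ^ k * Ring.choose β k

lemma binomC_zero (β : ℝ) : binomC β 0 = 1 := by simp [binomC]

lemma binomC_succ (β : ℝ) (k : ℕ) : ((k : ℝ) + 1) * binomC β (k + 1) = (k - β) * binomC β k := by
  rw [binomC, binomC, Ring.choose_eq_smul, Ring.choose_eq_smul, descPochhammer_succ_right,
    Polynomial.smeval_mul, Nat.factorial_succ]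
  simp only [Polynomial.smeval_sub, Polynomial.smeval_X, Polynomial.smeval_natCast, pow_one,
    pow_zero, smul_eq_mul, nsmul_eq_mul]
  push_cast
  field_simp
  ring

lemma hasSum_binomC (β : ℝ) {x : ℝ} (hx : |x| < 1) :
    HasSum (fun k => binomC β k * x ^ k) ((1 - x) ^ β) := by
  have h := (Real.one_add_rpow_hasFPowerSeriesOnBall_zero (a := β)).hasSum (y := -x) (by
    rw [← ENNReal.ofReal_one, Metric.eball_ofReal]
    simpa using hx)
  rw [zero_add, ← sub_eq_add_neg] at h
  refine h.congr_fun fun k => ?_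
  rw [binomialSeries_apply]
  simp [binomC, neg_pow x]
  ring

/-- For `k > β` the recurrence reads `β |c_k| = k |c_k| - (k+1) |c_{k+1}|`, so partial sums
telescope and stay below `N |c_N| / β`. -/
lemma summable_abs_binomC {β : ℝ} (hβ : 0 < β) : Summable fun k => |binomC β k| := by
  obtain ⟨N, hN⟩ := exists_nat_gt β
  refine (summable_nat_add_iff N).1 ?_
  have hrec : ∀ k, β * |binomC β (k + N)| =
      ((k + N : ℕ) : ℝ) * |binomC β (k + N)| -
        ((k + 1 + N : ℕ) : ℝ) * |binomC β (k + 1 + N)| := by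
    intro k
    have h := congrArg abs (binomC_succ β (k + N))
    have h1 : (0 : ℝ) ≤ ((k + N : ℕ) : ℝ) - β := by
      push_cast
      have : (0 : ℝ) ≤ k := by positivity
      linarith
    rw [abs_mul, abs_mul, abs_of_nonneg h1, abs_of_nonneg (by positivity)] at h
    rw [show k + 1 + N = k + N + 1 by ring, Nat.cast_succ, h]
    ring
  refine summable_of_sum_range_le (c := (N : ℝ) * |binomC β N| / β) (fun _ => abs_nonneg _) ?_
  intro n
  rw [le_div_iff₀ hβ, mul_comm, Finset.mul_sum]
  simp_rw [hrec]
  rw [Finset.sum_range_sub' (fun k : ℕ => ((k + N : ℕ) : ℝ) * |binomC β (k + N)|), zero_add]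
  have : 0 ≤ ((n + N : ℕ) : ℝ) * |binomC β (n + N)| := by positivity
  linarith

lemma tendsto_binomC {β : ℝ} (hβ : 0 < β) : Tendsto (binomC β) atTop (𝓝 0) :=
  (summable_abs_binomC hβ).of_abs.tendsto_atTop_zero

/-- A real number that is not an integer stays away from all integers. -/
lemma exists_pos_le_abs_add_int {p : ℝ} (hp : ∀ m : ℤ, p ≠ m) :
    ∃ δ > 0, ∀ m : ℤ, δ ≤ |p + m| := by
  refine ⟨|p - round p|, abs_pos.2 (sub_ne_zero.2 (hp _)), fun m => ?_⟩
  have := round_le p (-m)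
  simpa using this

/-- The series `∑ c_k / (a + k)`, which continues the Beta function in `a`. -/
def betaSeries (β a : ℝ) : ℝ := ∑' k : ℕ, binomC β k / (a + k)

lemma abs_binomC_div_le {β p δ : ℝ} (hδ : 0 < δ) (h : ∀ m : ℤ, δ ≤ |p + m|) (m : ℤ) (k : ℕ) :
    |binomC β k / (p + m + k)| ≤ |binomC β k| * δ⁻¹ := by
  rw [abs_div, div_eq_mul_inv]
  refine mul_le_mul_of_nonneg_left (inv_anti₀ hδ ?_) (abs_nonneg _)
  have := h (m + k)
  push_cast at this
  rwa [← add_assoc] at this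

lemma summable_betaSeries {β a : ℝ} (hβ : 0 < β) (ha : ∀ m : ℤ, a ≠ m) :
    Summable fun k : ℕ => binomC β k / (a + k) := by
  obtain ⟨δ, hδ, h⟩ := exists_pos_le_abs_add_int ha
  refine Summable.of_norm_bounded ((summable_abs_binomC hβ).mul_right δ⁻¹) fun k => ?_
  have := abs_binomC_div_le (β := β) hδ h 0 k
  rwa [Int.cast_zero, add_zero] at this

/-- Uniformity over all integer translates is what gives `regPart` bounded coefficients and makes it
entire. -/
lemma exists_betaSeries_bound {β p : ℝ} (hβ : 0 < β) (hp : ∀ m : ℤ, p ≠ m) :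
    ∃ C, ∀ m : ℤ, |betaSeries β (p + m)| ≤ C := by
  obtain ⟨δ, hδ, h⟩ := exists_pos_le_abs_add_int hp
  exact ⟨_, fun m => tsum_of_norm_bounded (f := fun k : ℕ => binomC β k / (p + m + k))
    ((summable_abs_binomC hβ).mul_right δ⁻¹).hasSum
    (abs_binomC_div_le (β := β) hδ h m)⟩

/-- The partial sums of the two sides, with the left one taken one term longer, differ by exactly
`binomC β n`, which tends to zero. -/
lemma betaSeries_recurrence {β a : ℝ} (hβ : 0 < β) (ha : ∀ m : ℤ, a ≠ m) :
    a * betaSeries β a = (a + β + 1) * betaSeries β (a + 1) := by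
  have ha1 : ∀ m : ℤ, a + 1 ≠ m := fun m h => ha (m - 1) (by push_cast; linarith)
  have h1 := ((tendsto_add_atTop_iff_nat 1).2
    (summable_betaSeries hβ ha).hasSum.tendsto_sum_nat).const_mul a
  have h2 := (summable_betaSeries hβ ha1).hasSum.tendsto_sum_nat.const_mul (a + β + 1)
  have h3 := h1.sub h2
  have key : ∀ n, a * ∑ k ∈ Finset.range (n + 1), binomC β k / (a + k) -
      (a + β + 1) * ∑ k ∈ Finset.range n, binomC β k / (a + 1 + k) = binomC β n := by
    intro n
    induction n with
    | zero =>
      have : a ≠ 0 := by simpa using ha 0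
      simp [binomC_zero, this]
    | succ n ih =>
      have hne : a + 1 + (n : ℝ) ≠ 0 := fun h => ha (-(n + 1)) (by push_cast; linarith)
      have hb := binomC_succ β n
      rw [Finset.sum_range_succ, Finset.sum_range_succ (fun k : ℕ => binomC β k / (a + 1 + k)),
        mul_add, mul_add, add_sub_add_comm, ih, Nat.cast_succ,
        show a + ((n : ℝ) + 1) = a + 1 + n by ring]
      field_simp
      linear_combination (-1 : ℝ) * hb
  simp_rw [key] at h3
  exact sub_eq_zero.1 (tendsto_nhds_unique h3 (tendsto_binomC hβ))

/-! ### The incomplete Gamma integral -/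

open MeasureTheory Set

/-- The upper incomplete Gamma integral `∫_1^∞ y^(q-1) e^{-ty} dy`. -/
def upperGammaInt (q t : ℝ) : ℝ := ∫ y in Ioi (1 : ℝ), y ^ (q - 1) * Real.exp (-(t * y))

lemma integrableOn_rpow_mul_exp {s t : ℝ} (hs : -1 < s) (ht : 0 < t) :
    IntegrableOn (fun y : ℝ => y ^ s * Real.exp (-(t * y))) (Ioi 0) := by
  have h := integrableOn_rpow_mul_exp_neg_mul_rpow hs one_pos ht
  simpa [Real.rpow_one] using h

lemma integrableOn_Ioi_one_rpow_mul_exp (s : ℝ) {t : ℝ} (ht : 0 < t) :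
    IntegrableOn (fun y : ℝ => y ^ s * Real.exp (-(t * y))) (Ioi 1) := by
  have h := (integrableOn_rpow_mul_exp (s := max s 0) (lt_of_lt_of_le (by norm_num) (le_max_right _ _))
    ht).mono_set (Ioi_subset_Ioi zero_le_one)
  refine h.mono' ?_ ?_
  · exact (by fun_prop : Measurable fun y : ℝ => y ^ s * Real.exp (-(t * y))).aestronglyMeasurable
  · refine (ae_restrict_iff' measurableSet_Ioi).2 (ae_of_all _ fun y (hy : 1 < y) => ?_)
    have hy0 : 0 < y := one_pos.trans hy
    rw [Real.norm_eq_abs, abs_of_nonneg (by positivity)]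
    exact mul_le_mul_of_nonneg_right (Real.rpow_le_rpow_of_exponent_le hy.le (le_max_left _ _))
      (Real.exp_pos _).le

lemma upperGammaInt_add_one (q : ℝ) {t : ℝ} (ht : 0 < t) :
    t * upperGammaInt (q + 1) t = Real.exp (-t) + q * upperGammaInt q t := by
  have hd : ∀ y ∈ Ici (1 : ℝ), HasDerivAt (fun y : ℝ => y ^ q * Real.exp (-(t * y)))
      (q * (y ^ (q - 1) * Real.exp (-(t * y))) - t * (y ^ (q + 1 - 1) * Real.exp (-(t * y)))) y := by
    intro y hy
    have hy0 : 0 < y := one_pos.trans_le hy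
    have h0 : HasDerivAt (fun y : ℝ => -(t * y)) (-t) y := by
      simpa using ((hasDerivAt_id y).const_mul t).fun_neg
    refine ((Real.hasDerivAt_rpow_const (p := q) (Or.inl hy0.ne')).mul h0.exp).congr_deriv ?_
    simp only [add_sub_cancel_right]
    ring
  have i1 := (integrableOn_Ioi_one_rpow_mul_exp (q - 1) ht).const_mul q
  have i2 := (integrableOn_Ioi_one_rpow_mul_exp (q + 1 - 1) ht).const_mul t
  have hlim : Tendsto (fun y : ℝ => y ^ q * Real.exp (-(t * y))) atTop (𝓝 0) := by
    simpa using tendsto_rpow_mul_exp_neg_mul_atTop_nhds_zero q t ht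
  have h := integral_Ioi_of_hasDerivAt_of_tendsto' hd (i1.sub i2) hlim
  rw [integral_sub i1 i2, integral_const_mul, integral_const_mul] at h
  simp only [Real.one_rpow, mul_one, one_mul, zero_sub] at h
  rw [upperGammaInt, upperGammaInt]
  linarith

/-- `Γ(q) t^(-q)` is the integral over `(0, ∞)`, so the difference is the integral over `(0, 1]`,
where the exponential series can be integrated termwise. -/
lemma hasSum_upperGammaInt_of_pos {q t : ℝ} (hq : 0 < q) (ht : 0 < t) :
    HasSum (fun j : ℕ => (-t) ^ j / (j.factorial * (q + j)))
      (Real.Gamma q * t ^ (-q) - upperGammaInt q t) := by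
  have hI := integrableOn_rpow_mul_exp (s := q - 1) (by linarith) ht
  have hG := Real.integral_rpow_mul_exp_neg_mul_Ioi hq ht
  have hsplit : Real.Gamma q * t ^ (-q) - upperGammaInt q t =
      ∫ y in Ioc (0 : ℝ) 1, y ^ (q - 1) * Real.exp (-(t * y)) := by
    rw [← Ioc_union_Ioi_eq_Ioi zero_le_one, setIntegral_union (Ioc_disjoint_Ioi le_rfl)
      measurableSet_Ioi (hI.mono_set Ioc_subset_Ioi_self)
      (hI.mono_set (Ioi_subset_Ioi zero_le_one))] at hG
    rw [upperGammaInt, eq_comm, eq_sub_iff_add_eq, hG, one_div, Real.inv_rpow ht.le,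
      Real.rpow_neg ht.le]
    ring
  have hint : ∀ j : ℕ, IntegrableOn (fun y : ℝ => y ^ (q - 1 + j)) (Ioc 0 1) := fun j => by
    rw [integrableOn_Ioc_iff_integrableOn_Ioo, intervalIntegral.integrableOn_Ioo_rpow_iff one_pos]
    have : (0 : ℝ) ≤ j := by positivity
    linarith
  have hval : ∀ j : ℕ, ∫ y in Ioc (0 : ℝ) 1, y ^ (q - 1 + j) = 1 / (q + j) := fun j => by
    have : (0 : ℝ) ≤ j := by positivity
    rw [← intervalIntegral.integral_of_le zero_le_one, integral_rpow (Or.inl (by linarith)),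
      show q - 1 + j + 1 = q + j by ring, Real.one_rpow, Real.zero_rpow (by positivity), sub_zero]
  have hs := hasSum_integral_of_summable_integral_norm (μ := volume.restrict (Ioc (0 : ℝ) 1))
    (F := fun (j : ℕ) (y : ℝ) => (-t) ^ j / j.factorial * y ^ (q - 1 + j))
    (fun j => (hint j).const_mul _) (by
      have : ∀ j : ℕ, ∫ y in Ioc (0 : ℝ) 1, ‖(-t) ^ j / (j.factorial : ℝ) * y ^ (q - 1 + j)‖ =
          t ^ j / j.factorial * (1 / (q + j)) := fun j => by
        rw [← hval, ← integral_const_mul]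
        refine setIntegral_congr_fun measurableSet_Ioc fun y hy => ?_
        simp only [norm_mul, norm_div, norm_pow, norm_neg, Real.norm_eq_abs, abs_of_pos ht,
          Nat.abs_cast, abs_of_nonneg (Real.rpow_nonneg hy.1.le _)]
      simp_rw [this]
      refine Summable.of_nonneg_of_le (fun j => by positivity) (fun j => ?_)
        ((Real.summable_pow_div_factorial t).mul_right (1 / q))
      gcongr
      linarith [(Nat.cast_nonneg j : (0 : ℝ) ≤ j)])
  have hval2 : ∫ y in Ioc (0 : ℝ) 1, y ^ (q - 1) * Real.exp (-(t * y)) =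
      ∫ y in Ioc (0 : ℝ) 1, ∑' j : ℕ, (-t) ^ j / (j.factorial : ℝ) * y ^ (q - 1 + j) := by
    refine setIntegral_congr_fun measurableSet_Ioc fun y hy => ?_
    rw [Real.exp_eq_exp_ℝ, NormedSpace.exp_eq_tsum_div, ← tsum_mul_left]
    refine tsum_congr fun j => ?_
    rw [Real.rpow_add hy.1, Real.rpow_natCast, ← neg_mul, mul_pow]
    ring
  rw [hsplit, hval2]
  refine hs.congr_fun fun j => ?_
  rw [integral_const_mul, hval]
  field_simp

/-- Both sides obey the same recurrence between `q` and `q + 1` (integration by parts on the right),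
so the case `q > 0` descends to every non-integer `q`. -/
lemma hasSum_upperGammaInt {q t : ℝ} (hq : ∀ m : ℤ, q ≠ m) (ht : 0 < t) :
    HasSum (fun j : ℕ => (-t) ^ j / (j.factorial * (q + j)))
      (Real.Gamma q * t ^ (-q) - upperGammaInt q t) := by
  suffices ∀ n : ℕ, ∀ q : ℝ, (∀ m : ℤ, q ≠ m) → 0 < q + n →
      HasSum (fun j : ℕ => (-t) ^ j / (j.factorial * (q + j)))
        (Real.Gamma q * t ^ (-q) - upperGammaInt q t) by
    obtain ⟨n, hn⟩ := exists_nat_gt (-q)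
    exact this n q hq (by linarith)
  intro n
  induction n with
  | zero => exact fun q _ h => hasSum_upperGammaInt_of_pos (by simpa using h) ht
  | succ n ih =>
    intro q hq h
    have hq0 : q ≠ 0 := by simpa using hq 0
    have hstep := ih (q + 1) (fun m hm => hq (m - 1) (by push_cast; linarith))
      (by push_cast at h; linarith)
    have hexp : HasSum (fun j : ℕ => (-t) ^ j / (j.factorial : ℝ)) (Real.exp (-t)) := by
      rw [Real.exp_eq_exp_ℝ]
      exact NormedSpace.expSeries_div_hasSum_exp (-t)
    have hshift : HasSum (fun j : ℕ => (j : ℝ) * ((-t) ^ j / (j.factorial * (q + j))))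
        ((-t) * (Real.Gamma (q + 1) * t ^ (-(q + 1)) - upperGammaInt (q + 1) t)) := by
      rw [← hasSum_nat_add_iff' 1]
      simp only [Finset.range_one, Finset.sum_singleton, Nat.cast_zero, zero_mul, sub_zero]
      refine (hstep.mul_left (-t)).congr_fun fun j => ?_
      rw [Nat.factorial_succ, pow_succ]
      have : q + 1 + (j : ℝ) ≠ 0 := fun hm => hq (-(j + 1)) (by push_cast; linarith)
      push_cast
      rw [show q + ((j : ℝ) + 1) = q + 1 + j by ring]
      field_simp
    have hfin := (hexp.sub hshift).mul_left q⁻¹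
    have hK := upperGammaInt_add_one q ht
    have hval : Real.Gamma q * t ^ (-q) - upperGammaInt q t = q⁻¹ * (Real.exp (-t) -
        -t * (Real.Gamma (q + 1) * t ^ (-(q + 1)) - upperGammaInt (q + 1) t)) := by
      rw [Real.Gamma_add_one hq0, show -(q + 1) = -q - 1 by ring, Real.rpow_sub_one ht.ne']
      field_simp
      linarith
    rw [hval]
    refine hfin.congr_fun fun j => ?_
    have : q + (j : ℝ) ≠ 0 := fun hm => hq (-j) (by push_cast; linarith)
    field_simp
    ring

/-! ### The moments as functions of `t` -/

/-- The integral `∫_0^1 x^(p-1) (1-x)^β e^{-t/x} dx`. -/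
def pjInt (β p : ℝ) (t : ℂ) : ℂ :=
  ∫ x in Ioo (0 : ℝ) 1, ((x ^ (p - 1) * (1 - x) ^ β : ℝ) : ℂ) * Complex.exp (-t / (x : ℂ))

lemma pjMoment_eq_pjInt (m : ℕ) (t : ℂ) (α β : ℝ) :
    pjMoment m t α β = pjInt β (α + 1 + m) t := by
  rw [pjMoment, intervalIntegral.integral_of_le zero_le_one, integral_Ioc_eq_integral_Ioo, pjInt]
  refine setIntegral_congr_fun measurableSet_Ioo fun x hx => ?_
  simp only [pjWeight]
  rw [show α + 1 + (m : ℝ) - 1 = α + m by ring, Real.rpow_add hx.1, Real.rpow_natCast]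
  push_cast
  ring

lemma norm_exp_neg_div_le_one {t : ℂ} (ht : 0 ≤ t.re) {x : ℝ} (hx : 0 < x) :
    ‖Complex.exp (-t / (x : ℂ))‖ ≤ 1 := by
  rw [Complex.norm_exp, Complex.div_ofReal_re, Complex.neg_re]
  exact Real.exp_le_one_iff.2 (div_nonpos_of_nonpos_of_nonneg (by linarith) hx.le)

lemma integrableOn_Ioo_rpow {p : ℝ} (hp : 0 < p) :
    IntegrableOn (fun x : ℝ => x ^ (p - 1)) (Ioo 0 1) :=
  (intervalIntegral.integrableOn_Ioo_rpow_iff one_pos).2 (by linarith)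

lemma integral_Ioo_rpow {p : ℝ} (hp : 0 < p) : ∫ x in Ioo (0 : ℝ) 1, x ^ (p - 1) = 1 / p := by
  rw [← integral_Ioc_eq_integral_Ioo, ← intervalIntegral.integral_of_le zero_le_one,
    integral_rpow (Or.inl (by linarith)), sub_add_cancel, Real.one_rpow, Real.zero_rpow hp.ne',
    sub_zero]

lemma norm_rpow_mul_exp_le {t : ℂ} (ht : 0 ≤ t.re) (s : ℝ) {x : ℝ} (hx : 0 < x) :
    ‖((x ^ s : ℝ) : ℂ) * Complex.exp (-t / (x : ℂ))‖ ≤ x ^ s := by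
  rw [norm_mul, Complex.norm_real, Real.norm_eq_abs, abs_of_nonneg (by positivity)]
  exact mul_le_of_le_one_right (by positivity) (norm_exp_neg_div_le_one ht hx)

lemma integrableOn_rpow_mul_cexp {p : ℝ} (hp : 0 < p) {t : ℂ} (ht : 0 ≤ t.re) :
    IntegrableOn (fun x : ℝ => ((x ^ (p - 1) : ℝ) : ℂ) * Complex.exp (-t / (x : ℂ))) (Ioo 0 1) := by
  refine (integrableOn_Ioo_rpow hp).mono' ?_ ?_
  · exact (by fun_prop : Measurable fun x : ℝ => ((x ^ (p - 1) : ℝ) : ℂ) *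
      Complex.exp (-t / (x : ℂ))).aestronglyMeasurable
  · exact (ae_restrict_iff' measurableSet_Ioo).2
      (ae_of_all _ fun x hx => norm_rpow_mul_exp_le ht _ hx.1)

lemma hasSum_pjInt {β p : ℝ} (hβ : 0 < β) (hp : 0 < p) {t : ℂ} (ht : 0 ≤ t.re) :
    HasSum (fun k : ℕ => (binomC β k : ℂ) * ∫ x in Ioo (0 : ℝ) 1,
      ((x ^ (p + k - 1) : ℝ) : ℂ) * Complex.exp (-t / (x : ℂ))) (pjInt β p t) := by
  have hpk : ∀ k : ℕ, 0 < p + k := fun k => by positivity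
  have hs := hasSum_integral_of_summable_integral_norm (μ := volume.restrict (Ioo (0 : ℝ) 1))
    (F := fun (k : ℕ) (x : ℝ) => (binomC β k : ℂ) *
      (((x ^ (p + k - 1) : ℝ) : ℂ) * Complex.exp (-t / (x : ℂ))))
    (fun k => (integrableOn_rpow_mul_cexp (hpk k) ht).const_mul _) (by
      refine Summable.of_nonneg_of_le (fun k => integral_nonneg fun _ => norm_nonneg _)
        (fun k => ?_) ((summable_abs_binomC hβ).mul_right (1 / p))
      calc ∫ x in Ioo (0 : ℝ) 1, ‖(binomC β k : ℂ) *
            (((x ^ (p + k - 1) : ℝ) : ℂ) * Complex.exp (-t / (x : ℂ)))‖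
          ≤ ∫ x in Ioo (0 : ℝ) 1, |binomC β k| * x ^ (p + k - 1) := by
            refine setIntegral_mono_on ((integrableOn_rpow_mul_cexp (hpk k) ht).const_mul _).norm
              ((integrableOn_Ioo_rpow (hpk k)).const_mul _) measurableSet_Ioo fun x hx => ?_
            rw [norm_mul, Complex.norm_real, Real.norm_eq_abs]
            exact mul_le_mul_of_nonneg_left (norm_rpow_mul_exp_le ht _ hx.1) (abs_nonneg _)
        _ = |binomC β k| * (1 / (p + k)) := by
            rw [integral_const_mul, integral_Ioo_rpow (hpk k)]
        _ ≤ |binomC β k| * (1 / p) := by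
            gcongr
            linarith [(Nat.cast_nonneg k : (0 : ℝ) ≤ k)])
  have hval : pjInt β p t = ∫ x in Ioo (0 : ℝ) 1, ∑' k : ℕ, (binomC β k : ℂ) *
      (((x ^ (p + k - 1) : ℝ) : ℂ) * Complex.exp (-t / (x : ℂ))) := by
    refine setIntegral_congr_fun measurableSet_Ioo fun x hx => ?_
    have h1 := hasSum_binomC β (x := x) (by rw [abs_of_pos hx.1]; exact hx.2)
    have h2 := ((Complex.hasSum_ofReal.2 h1).mul_left ((x ^ (p - 1) : ℝ) : ℂ)).mul_right
      (Complex.exp (-t / (x : ℂ)))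
    rw [Complex.ofReal_mul, ← h2.tsum_eq]
    refine tsum_congr fun k => ?_
    rw [show p + (k : ℝ) - 1 = p - 1 + k by ring, Real.rpow_add hx.1, Real.rpow_natCast]
    push_cast
    ring
  rw [hval]
  exact hs.congr_fun fun k => (integral_const_mul _ _).symm

lemma pjInt_zero {β p : ℝ} (hβ : 0 < β) (hp : 0 < p) :
    pjInt β p 0 = (gammaBeta p (β + 1) : ℝ) := by
  have h : pjInt β p 0 = Complex.betaIntegral p ((β + 1 : ℝ) : ℂ) := by
    rw [Complex.betaIntegral, intervalIntegral.integral_of_le zero_le_one,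
      integral_Ioc_eq_integral_Ioo, pjInt]
    refine setIntegral_congr_fun measurableSet_Ioo fun x hx => ?_
    have hx1 : 0 ≤ 1 - x := by linarith [hx.2]
    simp only [neg_zero, zero_div, Complex.exp_zero, mul_one]
    rw [Complex.ofReal_mul, Complex.ofReal_cpow hx.1.le, Complex.ofReal_cpow hx1]
    push_cast
    simp
  rw [h, Complex.betaIntegral_eq_Gamma_mul_div _ _ (by simpa using hp)
    (by simpa using (by linarith : 0 < β + 1)), gammaBeta]
  rw [← Complex.ofReal_add]
  simp only [Complex.Gamma_ofReal]
  push_cast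
  rfl

lemma betaSeries_of_pos {β a : ℝ} (hβ : 0 < β) (ha : 0 < a) :
    betaSeries β a = gammaBeta a (β + 1) := by
  have h := hasSum_pjInt hβ ha (t := 0) le_rfl
  rw [pjInt_zero hβ ha] at h
  have h2 : HasSum (fun k : ℕ => ((binomC β k / (a + k) : ℝ) : ℂ))
      (gammaBeta a (β + 1) : ℝ) := by
    refine h.congr_fun fun k => ?_
    simp only [neg_zero, zero_div, Complex.exp_zero, mul_one]
    rw [integral_complex_ofReal, integral_Ioo_rpow (by positivity : 0 < a + (k : ℝ)), ← Complex.ofReal_mul,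
      mul_one_div]
  exact (Complex.hasSum_ofReal.1 h2).tsum_eq

/-- One downward step of the recurrence from `a + 1 > 0`. This range suffices, since the lowest
parameter needed later is `α - 1`. -/
lemma betaSeries_of_neg_one_lt {β a : ℝ} (hβ : 0 < β) (ha : -1 < a) (ha' : ∀ m : ℤ, a ≠ m) :
    betaSeries β a = gammaBeta a (β + 1) := by
  have ha0 : a ≠ 0 := by simpa using ha' 0
  have h := betaSeries_recurrence hβ ha'
  rw [betaSeries_of_pos hβ (by linarith : 0 < a + 1), gammaBeta, Real.Gamma_add_one ha0,
    show a + 1 + (β + 1) = a + (β + 1) + 1 by ring,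
    Real.Gamma_add_one (s := a + (β + 1)) (by linarith)] at h
  rw [← mul_right_inj' ha0, h, gammaBeta]
  have h1 : a + (β + 1) ≠ 0 := by linarith
  have h2 := (Real.Gamma_pos_of_pos (s := a + (β + 1)) (by linarith)).ne'
  field_simp
  ring

lemma integral_rpow_mul_exp_neg_div (p t : ℝ) :
    ∫ x in Ioo (0 : ℝ) 1, x ^ (p - 1) * Real.exp (-t / x) = upperGammaInt (-p) t := by
  have himg : (fun y : ℝ => y⁻¹) '' Ioi 1 = Ioo 0 1 := by
    rw [Set.image_inv_eq_inv, inv_Ioi₀ one_pos, inv_one]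
  rw [← himg, integral_image_eq_integral_abs_deriv_smul measurableSet_Ioi
    (fun y (hy : 1 < y) => (hasDerivAt_inv (one_pos.trans hy).ne').hasDerivWithinAt)
    inv_injective.injOn, upperGammaInt]
  refine setIntegral_congr_fun measurableSet_Ioi fun y (hy : 1 < y) => ?_
  have hy0 : 0 < y := one_pos.trans hy
  simp only [smul_eq_mul]
  rw [abs_neg, abs_of_nonneg (by positivity), Real.inv_rpow hy0.le, ← Real.rpow_neg hy0.le,
    ← Real.rpow_natCast, ← Real.rpow_neg hy0.le, ← mul_assoc, ← Real.rpow_add hy0, div_inv_eq_mul,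
    neg_mul]
  congr 2
  push_cast
  ring

/-- The part of the moment integral that is analytic at the origin. -/
def regPart (β p : ℝ) : ℂ → ℂ := egf fun j => (((-1) ^ j * betaSeries β (p - j) : ℝ) : ℂ)

/-- The factor of `t^p` in the moment integral. -/
def singPart (β p : ℝ) : ℂ → ℂ :=
  egf fun k => ((binomC β k * Real.Gamma (-(p + k)) * (k.factorial : ℝ) : ℝ) : ℂ)

lemma exists_regPart_bound {β p : ℝ} (hβ : 0 < β) (hp : ∀ m : ℤ, p ≠ m) :
    ∃ C, ∀ j : ℕ, ‖(((-1) ^ j * betaSeries β (p - j) : ℝ) : ℂ)‖ ≤ C := by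
  obtain ⟨C, hC⟩ := exists_betaSeries_bound hβ hp
  refine ⟨C, fun j => ?_⟩
  have := hC (-j)
  push_cast at this
  rw [Complex.norm_real, Real.norm_eq_abs, abs_mul, abs_pow, abs_neg, abs_one, one_pow, one_mul]
  exact this

lemma hasDerivAt_regPart {β p : ℝ} (hβ : 0 < β) (hp : ∀ m : ℤ, p ≠ m) (t : ℂ) :
    HasDerivAt (regPart β p) (-regPart β (p - 1) t) t := by
  obtain ⟨C, hC⟩ := exists_regPart_bound hβ hp
  refine (hasDerivAt_egf hC t).congr_deriv ?_
  rw [regPart, egf, egf, ← tsum_neg]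
  refine tsum_congr fun k => ?_
  rw [show p - ((k + 1 : ℕ) : ℝ) = p - 1 - k by push_cast; ring]
  push_cast
  ring

lemma differentiable_regPart {β p : ℝ} (hβ : 0 < β) (hp : ∀ m : ℤ, p ≠ m) :
    Differentiable ℂ (regPart β p) := fun t => (hasDerivAt_regPart hβ hp t).differentiableAt

lemma regPart_zero {β p : ℝ} (hβ : 0 < β) (hp : -1 < p) (hp' : ∀ m : ℤ, p ≠ m) :
    regPart β p 0 = (gammaBeta p (β + 1) : ℝ) := by
  rw [regPart, egf_zero, ← betaSeries_of_neg_one_lt hβ hp hp']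
  simp

/-- Each step divides the Gamma value by `-(p + k + 1)`, which outweighs the new factor `k + 1` of
the factorial. -/
lemma abs_Gamma_neg_mul_factorial_le {p : ℝ} (hp : 0 < p) (k : ℕ) :
    |Real.Gamma (-(p + k)) * (k.factorial : ℝ)| ≤ |Real.Gamma (-p)| := by
  induction k with
  | zero => simp
  | succ k ih =>
    have hpos : 0 < p + k + 1 := by positivity
    have h := Real.Gamma_add_one (s := -(p + (k + 1 : ℕ))) (by push_cast; linarith)
    rw [show -(p + ((k + 1 : ℕ) : ℝ)) + 1 = -(p + k) by push_cast; ring] at h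
    refine le_trans ?_ ih
    rw [h, Nat.factorial_succ, abs_mul, abs_mul, abs_mul, abs_neg,
      abs_of_pos (show 0 < p + ((k + 1 : ℕ) : ℝ) by positivity), Nat.cast_mul, abs_mul,
      abs_of_nonneg (Nat.cast_nonneg (k + 1) : (0 : ℝ) ≤ ((k + 1 : ℕ) : ℝ)), mul_comm
      (p + ((k + 1 : ℕ) : ℝ)), mul_assoc]
    gcongr
    linarith

lemma exists_singPart_bound {β p : ℝ} (hβ : 0 < β) (hp : 0 < p) :
    ∃ C, ∀ k : ℕ,
      ‖((binomC β k * Real.Gamma (-(p + k)) * (k.factorial : ℝ) : ℝ) : ℂ)‖ ≤ C := by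
  refine ⟨(∑' k, |binomC β k|) * |Real.Gamma (-p)|, fun k => ?_⟩
  rw [Complex.norm_real, Real.norm_eq_abs, mul_assoc, abs_mul]
  exact mul_le_mul ((summable_abs_binomC hβ).le_tsum k fun _ _ => abs_nonneg _)
    (abs_Gamma_neg_mul_factorial_le hp k) (abs_nonneg _) (tsum_nonneg fun _ => abs_nonneg _)

lemma differentiable_singPart {β p : ℝ} (hβ : 0 < β) (hp : 0 < p) :
    Differentiable ℂ (singPart β p) := by
  obtain ⟨C, hC⟩ := exists_singPart_bound hβ hp
  exact differentiable_egf hC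

lemma singPart_zero (β p : ℝ) : singPart β p 0 = (Real.Gamma (-p) : ℝ) := by
  rw [singPart, egf_zero]
  simp [binomC_zero]

lemma pjInt_ofReal_eq {β p t : ℝ} (hβ : 0 < β) (hp : 0 < p) (hp' : ∀ m : ℤ, p ≠ m) (ht : 0 < t) :
    pjInt β p t = regPart β p t + (t : ℂ) ^ (p : ℂ) * singPart β p t := by
  have hne : ∀ k : ℕ, ∀ m : ℤ, -(p + k) ≠ m := fun k m h =>
    hp' (-(m + k)) (by push_cast; linarith)
  have h1 := hasSum_pjInt hβ hp (t := t) ht.le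
  have hJ : ∀ k : ℕ, ∫ x in Ioo (0 : ℝ) 1,
      ((x ^ (p + k - 1) : ℝ) : ℂ) * Complex.exp (-(t : ℂ) / (x : ℂ)) =
      ((upperGammaInt (-(p + k)) t : ℝ) : ℂ) := fun k => by
    rw [← integral_rpow_mul_exp_neg_div, ← integral_complex_ofReal]
    exact integral_congr_ae (ae_of_all _ fun x => by push_cast; rfl)
  simp_rw [hJ] at h1
  obtain ⟨C, hC⟩ := exists_singPart_bound hβ hp
  have h2 : HasSum (fun k : ℕ => (binomC β k : ℂ) *
      ((Real.Gamma (-(p + k)) * t ^ (p + k) : ℝ) : ℂ))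
      ((t : ℂ) ^ (p : ℂ) * singPart β p t) := by
    refine ((summable_egf hC t).hasSum.mul_left ((t : ℂ) ^ (p : ℂ))).congr_fun fun k => ?_
    have : ((k.factorial : ℝ) : ℂ) ≠ 0 := by exact_mod_cast k.factorial_ne_zero
    rw [Real.rpow_add ht, Real.rpow_natCast]
    push_cast [Complex.ofReal_cpow ht.le] at this ⊢
    field_simp
  have h3 := h1.sub h2
  -- Summing over `j` first gives the incomplete Gamma integrals without their `t^(p+k)` terms;
  -- summing over `k` first gives `betaSeries β (p - j)`, the coefficients of `regPart`.
  set f : ℕ → ℕ → ℝ := fun k j => binomC β k / (p - j + k) * ((-t) ^ j / j.factorial) with hf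
  have hinner : ∀ k : ℕ, ∑' j, f k j =
      binomC β k * (upperGammaInt (-(p + k)) t - Real.Gamma (-(p + k)) * t ^ (p + k)) := by
    intro k
    have h := (hasSum_upperGammaInt (hne k) ht).mul_left (-(binomC β k))
    rw [neg_neg] at h
    rw [show binomC β k * (upperGammaInt (-(p + k)) t - Real.Gamma (-(p + k)) * t ^ (p + k)) =
      -binomC β k * (Real.Gamma (-(p + k)) * t ^ (p + k) - upperGammaInt (-(p + k)) t) by ring,
      ← h.tsum_eq]
    refine tsum_congr fun j => ?_
    have e : -(p + (k : ℝ)) + j = -(p - j + k) := by ring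
    have e2 : p - j + (k : ℝ) ≠ 0 := fun h0 => hp' (j - k) (by push_cast; linarith)
    rw [hf, e]
    field_simp
  obtain ⟨δ, hδ, hδp⟩ := exists_pos_le_abs_add_int hp'
  have hsum : Summable (Function.uncurry f) := by
    have hb := ((summable_abs_binomC hβ).mul_right δ⁻¹).mul_of_nonneg
      (Real.summable_pow_div_factorial t) (fun k => by positivity) (fun j => by positivity)
    refine Summable.of_norm_bounded hb fun x => ?_
    have h := abs_binomC_div_le (β := β) hδ hδp (-x.2) x.1
    push_cast at h
    simp only [Function.uncurry, hf, Real.norm_eq_abs]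
    rw [abs_mul, abs_div ((-t) ^ x.2), abs_pow, abs_neg, abs_of_pos ht, Nat.abs_cast]
    exact mul_le_mul_of_nonneg_right h (by positivity)
  have hcomm : ∑' k, ∑' j, f k j = ∑' j, ∑' k, f k j := hsum.tsum_comm.symm
  have hreg : regPart β p t = ((∑' j, ∑' k, f k j : ℝ) : ℂ) := by
    rw [regPart, egf, Complex.ofReal_tsum]
    refine tsum_congr fun j => ?_
    rw [hf]
    simp only
    rw [tsum_mul_right, ← betaSeries, neg_pow t]
    push_cast
    ring
  have h4 : pjInt β p t - (t : ℂ) ^ (p : ℂ) * singPart β p t = regPart β p t := by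
    rw [hreg, ← hcomm, Complex.ofReal_tsum, ← h3.tsum_eq]
    refine tsum_congr fun k => ?_
    rw [hinner]
    push_cast
    ring
  rw [← h4]
  ring

lemma measurable_pjInt_integrand (β s : ℝ) (t : ℂ) :
    Measurable fun x : ℝ => ((x ^ s * (1 - x) ^ β : ℝ) : ℂ) * Complex.exp (-t / (x : ℂ)) := by
  fun_prop

lemma norm_pjInt_integrand_le {β : ℝ} (hβ : 0 < β) (s : ℝ) {t : ℂ} (ht : 0 ≤ t.re) {x : ℝ}
    (hx : x ∈ Ioo (0 : ℝ) 1) :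
    ‖((x ^ s * (1 - x) ^ β : ℝ) : ℂ) * Complex.exp (-t / (x : ℂ))‖ ≤ x ^ s := by
  have h0 : 0 < x := hx.1
  have h1 : 0 ≤ 1 - x := by linarith [hx.2]
  rw [norm_mul, Complex.norm_real, Real.norm_eq_abs, abs_of_nonneg (by positivity)]
  calc x ^ s * (1 - x) ^ β * ‖Complex.exp (-t / (x : ℂ))‖ ≤ x ^ s * (1 - x) ^ β :=
        mul_le_of_le_one_right (by positivity) (norm_exp_neg_div_le_one ht h0)
    _ ≤ x ^ s := mul_le_of_le_one_right (by positivity)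
        (Real.rpow_le_one h1 (by linarith) hβ.le)

lemma continuousOn_pjInt {β p : ℝ} (hβ : 0 < β) (hp : 0 < p) :
    ContinuousOn (pjInt β p) {t | 0 ≤ t.re} := by
  refine continuousOn_of_dominated (bound := fun x => x ^ (p - 1))
    (fun t _ => (measurable_pjInt_integrand β _ t).aestronglyMeasurable) (fun t ht => ?_)
    (integrableOn_Ioo_rpow hp) (ae_of_all _ fun x => ?_)
  · exact (ae_restrict_iff' measurableSet_Ioo).2
      (ae_of_all _ fun x hx => norm_pjInt_integrand_le hβ _ ht hx)
  · fun_prop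

/-- Differentiating in `t` costs a factor `1/x`, so the dominating function is `x^(p-2)`; hence `1 <
p`. -/
lemma differentiableOn_pjInt {β p : ℝ} (hβ : 0 < β) (hp : 1 < p) :
    DifferentiableOn ℂ (pjInt β p) {t | 0 < t.re} := by
  intro t ht
  have hopen : IsOpen {t : ℂ | 0 < t.re} := isOpen_lt continuous_const Complex.continuous_re
  have h := (hasDerivAt_integral_of_dominated_loc_of_deriv_le
    (μ := volume.restrict (Ioo (0 : ℝ) 1)) (s := {t : ℂ | 0 < t.re})
    (F := fun t x => ((x ^ (p - 1) * (1 - x) ^ β : ℝ) : ℂ) * Complex.exp (-t / (x : ℂ)))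
    (F' := fun t x => -(((x ^ (p - 1 - 1) * (1 - x) ^ β : ℝ) : ℂ) * Complex.exp (-t / (x : ℂ))))
    (bound := fun x => x ^ (p - 1 - 1)) (x₀ := t) (hopen.mem_nhds ht)
    (Eventually.of_forall fun t => (measurable_pjInt_integrand β _ t).aestronglyMeasurable) ?_
    (measurable_pjInt_integrand β _ t).neg.aestronglyMeasurable ?_
    (integrableOn_Ioo_rpow (by linarith)) ?_).2
  · exact h.differentiableAt.differentiableWithinAt
  · refine (integrableOn_Ioo_rpow (by linarith : 0 < p)).mono'
      (measurable_pjInt_integrand β _ t).aestronglyMeasurable ?_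
    exact (ae_restrict_iff' measurableSet_Ioo).2
      (ae_of_all _ fun x hx => norm_pjInt_integrand_le hβ _ (le_of_lt ht) hx)
  · refine (ae_restrict_iff' measurableSet_Ioo).2 (ae_of_all _ fun x hx s hs => ?_)
    rw [norm_neg]
    exact norm_pjInt_integrand_le hβ _ (le_of_lt hs) hx
  · refine (ae_restrict_iff' measurableSet_Ioo).2 (ae_of_all _ fun x hx s hs => ?_)
    have hx0 : (x : ℂ) ≠ 0 := by exact_mod_cast hx.1.ne'
    have h1 := (((hasDerivAt_id s).neg.div_const (x : ℂ)).cexp).const_mul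
      ((x ^ (p - 1) * (1 - x) ^ β : ℝ) : ℂ)
    refine h1.congr_deriv ?_
    rw [Real.rpow_sub_one hx.1.ne' (p - 1)]
    push_cast
    simp only [Pi.neg_apply, id]
    field_simp

lemma differentiableOn_regPart_add_singPart {β p : ℝ} (hβ : 0 < β) (hp : 0 < p)
    (hp' : ∀ m : ℤ, p ≠ m) :
    DifferentiableOn ℂ (fun t => regPart β p t + t ^ (p : ℂ) * singPart β p t)
      Complex.slitPlane := fun t ht =>
  ((differentiable_regPart hβ hp' t).add
    ((differentiableAt_id.cpow (differentiableAt_const _) ht).mul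
      (differentiable_singPart hβ hp t))).differentiableWithinAt

lemma pjInt_eq_of_re_pos {β p : ℝ} (hβ : 0 < β) (hp : 1 < p) (hp' : ∀ m : ℤ, p ≠ m) {t : ℂ}
    (ht : 0 < t.re) : pjInt β p t = regPart β p t + t ^ (p : ℂ) * singPart β p t := by
  have hopen : IsOpen {t : ℂ | 0 < t.re} := isOpen_lt continuous_const Complex.continuous_re
  have hconv : Convex ℝ {t : ℂ | 0 < t.re} := convex_halfSpace_re_gt 0
  have h1 := (differentiableOn_pjInt hβ hp).analyticOnNhd hopen
  have h2 := ((differentiableOn_regPart_add_singPart hβ (by linarith) hp').mono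
    (fun t (ht : 0 < t.re) => Or.inl ht)).analyticOnNhd hopen
  refine h1.eqOn_of_preconnected_of_frequently_eq h2 hconv.isPreconnected (z₀ := 1)
    (by simp) ?_ ht
  -- Positive reals accumulating at `1`, where the real-variable identity is known, feed the
  -- identity theorem.
  have htend : Tendsto (fun n : ℕ => (((1 : ℝ) + 1 / ((n : ℝ) + 1) : ℝ) : ℂ)) atTop (𝓝[≠] 1) := by
    refine tendsto_nhdsWithin_iff.2 ⟨?_, Eventually.of_forall fun n => ?_⟩
    · have : Tendsto (fun n : ℕ => (1 : ℝ) + 1 / ((n : ℝ) + 1)) atTop (𝓝 1) := by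
        simpa using (tendsto_one_div_add_atTop_nhds_zero_nat (𝕜 := ℝ)).const_add 1
      have h := (Complex.continuous_ofReal.tendsto 1).comp this
      rw [Complex.ofReal_one] at h
      exact h
    · have : (1 : ℝ) / ((n : ℝ) + 1) ≠ 0 := by positivity
      simp only [mem_compl_iff, mem_singleton_iff]
      norm_cast
      simpa using this
  exact htend.frequently (Frequently.of_forall fun n =>
    pjInt_ofReal_eq hβ (by linarith) hp' (by positivity))

lemma pjInt_eq {β p : ℝ} (hβ : 0 < β) (hp : 1 < p) (hp' : ∀ m : ℤ, p ≠ m) {t : ℂ}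
    (ht : 0 ≤ t.re) (ht' : t ∈ Complex.slitPlane) :
    pjInt β p t = regPart β p t + t ^ (p : ℂ) * singPart β p t := by
  -- A boundary point is approached horizontally from the open half-plane, and both sides are
  -- continuous along the path.
  have hpath : Tendsto (fun ε : ℝ => t + ε) (𝓝[>] 0) (𝓝[{t : ℂ | 0 ≤ t.re}] t) := by
    refine tendsto_nhdsWithin_iff.2 ⟨?_, ?_⟩
    · have : Tendsto (fun ε : ℝ => t + (ε : ℂ)) (𝓝 0) (𝓝 (t + ((0 : ℝ) : ℂ))) :=
        (by fun_prop : Continuous fun ε : ℝ => t + (ε : ℂ)).tendsto 0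
      rw [Complex.ofReal_zero, add_zero] at this
      exact this.mono_left nhdsWithin_le_nhds
    · filter_upwards [self_mem_nhdsWithin] with ε (hε : 0 < ε)
      simp only [Complex.add_re, Complex.ofReal_re]
      linarith
  have h1 := (continuousOn_pjInt hβ (by linarith : 0 < p) t ht).tendsto.comp hpath
  have h2 := ((differentiableOn_regPart_add_singPart hβ (by linarith) hp').differentiableAt
    (Complex.isOpen_slitPlane.mem_nhds ht')).continuousAt.tendsto.comp
    (hpath.mono_right nhdsWithin_le_nhds)
  refine tendsto_nhds_unique h1 (h2.congr' ?_)
  filter_upwards [self_mem_nhdsWithin] with ε (hε : 0 < ε)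
  refine (pjInt_eq_of_re_pos hβ hp hp' ?_).symm
  simp only [Complex.add_re, Complex.ofReal_re]
  linarith

/-! ### Derivatives of determinants and Taylor expansion -/

lemma det_eq_sum_prod_row {n : ℕ} (M : Matrix (Fin n) (Fin n) ℂ) :
    M.det = ∑ σ : Equiv.Perm (Fin n), ((Equiv.Perm.sign σ : ℤ) : ℂ) * ∏ i, M i (σ i) := by
  rw [← Matrix.det_transpose, Matrix.det_apply']
  rfl

lemma hasDerivAt_det {n : ℕ} {M : ℂ → Matrix (Fin n) (Fin n) ℂ} {M' : Matrix (Fin n) (Fin n) ℂ}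
    {t : ℂ} (h : ∀ i j, HasDerivAt (fun s => M s i j) (M' i j) t) :
    HasDerivAt (fun s => (M s).det) (∑ i, ((M t).updateRow i (M' i)).det) t := by
  simp_rw [det_eq_sum_prod_row]
  have h1 := HasDerivAt.fun_sum (u := Finset.univ) fun (σ : Equiv.Perm (Fin n)) _ =>
    (HasDerivAt.fun_finsetProd (u := Finset.univ) fun i _ => h i (σ i)).const_mul
      ((Equiv.Perm.sign σ : ℤ) : ℂ)
  refine h1.congr_deriv ?_
  rw [Finset.sum_comm]
  refine Finset.sum_congr rfl fun σ _ => ?_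
  rw [Finset.mul_sum]
  refine Finset.sum_congr rfl fun i _ => ?_
  congr 1
  rw [← Finset.mul_prod_erase _ _ (Finset.mem_univ i), Matrix.updateRow_self, smul_eq_mul, mul_comm]
  congr 1
  refine Finset.prod_congr rfl fun j hj => ?_
  rw [Matrix.updateRow_ne (Finset.ne_of_mem_erase hj)]

lemma differentiable_det {n : ℕ} {M : ℂ → Matrix (Fin n) (Fin n) ℂ}
    (h : ∀ i j, Differentiable ℂ fun s => M s i j) : Differentiable ℂ fun s => (M s).det :=
  fun t => (hasDerivAt_det fun i j => (h i j t).hasDerivAt).differentiableAt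

lemma isBigO_sub_taylor_two {f g h : ℂ → ℂ} (hf : ∀ t, HasDerivAt f (g t) t)
    (hg : ∀ t, HasDerivAt g (h t) t) :
    (fun t => f t - (f 0 + g 0 * t + h 0 / 2 * t ^ 2)) =O[𝓝 0] fun t => t ^ 3 := by
  have hdf : Differentiable ℂ f := fun t => (hf t).differentiableAt
  have h1 : deriv f = g := funext fun t => (hf t).deriv
  have h2 : deriv g = h := funext fun t => (hg t).deriv
  have h3 := (hdf.analyticAt 0).hasFPowerSeriesAt.isBigO_sub_partialSum_pow 3
  refine (h3.congr_left fun t => ?_).trans (IsBigO.of_norm_left ?_)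
  · rw [FormalMultilinearSeries.partialSum]
    simp only [Finset.sum_range_succ, Finset.sum_range_zero, zero_add,
      FormalMultilinearSeries.ofScalars_apply_eq, iteratedDeriv_zero, iteratedDeriv_succ, h1, h2,
      smul_eq_mul]
    norm_num
  · simp only [norm_norm, norm_pow]
    exact IsBigO.of_bound 1 (Eventually.of_forall fun t => by simp)

/-! ### Determinants of the regular parts -/

/-- The determinant of the matrix of regular parts with row parameters `a`. -/
def regDet {n : ℕ} (β : ℝ) (a : Fin n → ℝ) (t : ℂ) : ℂ :=
  (Matrix.of fun i j : Fin n => regPart β (a i + (j : ℕ)) t).det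

lemma add_nat_ne_int {a : ℝ} (ha : ∀ m : ℤ, a ≠ m) (j : ℕ) (m : ℤ) : a + j ≠ m := fun h =>
  ha (m - j) (by push_cast; linarith)

lemma regDet_zero {n : ℕ} {β : ℝ} (hβ : 0 < β) {a : Fin n → ℝ} (ha : ∀ i, -1 < a i)
    (ha' : ∀ i, ∀ m : ℤ, a i ≠ m) : regDet β a 0 = (betaDet n (β + 1) a : ℝ) := by
  rw [regDet, betaDet, ← Complex.ofRealHom_eq_coe, RingHom.map_det]
  congr 1
  ext i j
  have : (0 : ℝ) ≤ ((j : ℕ) : ℝ) := by positivity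
  rw [Matrix.of_apply, regPart_zero hβ (by linarith [ha i]) (add_nat_ne_int (ha' i) j)]
  rfl

/-- Differentiating a row lowers its parameter by one, so the derivative stays within the family
`regDet`. -/
lemma hasDerivAt_regDet {n : ℕ} {β : ℝ} (hβ : 0 < β) {a : Fin n → ℝ}
    (ha : ∀ i, ∀ m : ℤ, a i ≠ m) (t : ℂ) :
    HasDerivAt (regDet β a) (-∑ i, regDet β (Function.update a i (a i - 1)) t) t := by
  refine (hasDerivAt_det
    (M := fun t => Matrix.of fun i j : Fin n => regPart β (a i + (j : ℕ)) t)
    (M' := Matrix.of fun i j : Fin n => -regPart β (a i + (j : ℕ) - 1) t)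
    fun i j => hasDerivAt_regPart hβ (add_nat_ne_int (ha i) j) t).congr_deriv ?_
  rw [← Finset.sum_neg_distrib]
  refine Finset.sum_congr rfl fun i _ => ?_
  have : (Matrix.of fun i j : Fin n => -regPart β (a i + (j : ℕ) - 1) t) i =
      (-1 : ℂ) • fun j : Fin n => regPart β (a i - 1 + (j : ℕ)) t := by
    ext j
    simp only [Matrix.of_apply, Pi.smul_apply, smul_eq_mul, neg_one_mul]
    rw [show a i + ((j : ℕ) : ℝ) - 1 = a i - 1 + (j : ℕ) by ring]
  rw [this, Matrix.det_updateRow_smul, neg_one_mul, regDet]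
  congr 2
  ext k j
  rw [Matrix.updateRow_apply, Matrix.of_apply, Matrix.of_apply, Function.update_apply]
  split_ifs <;> rfl

lemma regDet_eq_zero {n : ℕ} {β : ℝ} {a : Fin n → ℝ} {i k : Fin n} (hik : i ≠ k)
    (h : a i = a k) (t : ℂ) : regDet β a t = 0 :=
  Matrix.det_zero_of_row_eq hik (by ext j; simp [h])

lemma regDet_update_eq_zero {n : ℕ} {β : ℝ} {a : Fin n → ℝ} {i k : Fin n} (hik : i ≠ k)
    {x : ℝ} (h : a i = x) (t : ℂ) : regDet β (Function.update a k x) t = 0 :=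
  regDet_eq_zero hik (by rw [Function.update_of_ne hik, Function.update_self, h]) t

/-! ### Second-order Taylor expansion of the regular determinant -/

section expansion

variable {α β : ℝ}

lemma cons_param_ne (n : ℕ) (hα : ∀ m : ℤ, α ≠ m) {x : ℝ} (hx : ∀ m : ℤ, x ≠ m)
    (i : Fin (n + 1)) (m : ℤ) :
    (Fin.cons x fun i : Fin n => α + 1 + 1 + ((i : ℕ) : ℝ) : Fin (n + 1) → ℝ) i ≠ m := by
  refine Fin.cases (hx m) (fun i h => ?_) i
  rw [Fin.cons_succ] at h
  exact hα (m - 2 - (i : ℕ)) (by push_cast; linarith)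

/-- The row parameters are consecutive, so lowering any row but the first duplicates its
predecessor. -/
lemma hasDerivAt_regDet_base (n : ℕ) (hβ : 0 < β) (hα : ∀ m : ℤ, α ≠ m) (t : ℂ) :
    HasDerivAt (regDet β (Fin.cons (α + 1) fun i : Fin n => α + 1 + 1 + (i : ℕ)))
      (-regDet β (Fin.cons α fun i : Fin n => α + 1 + 1 + (i : ℕ)) t) t := by
  have hne := cons_param_ne n hα (x := α + 1)
    fun m h => hα (m - 1) (by push_cast; linarith)
  refine (hasDerivAt_regDet hβ hne t).congr_deriv ?_
  rw [Fin.sum_univ_succ, Fin.cons_zero, Fin.update_cons_zero, add_sub_cancel_right,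
    Finset.sum_eq_zero, add_zero]
  intro i _
  rcases n with _ | n
  · exact i.elim0
  refine Fin.cases ?_ (fun i => ?_) i
  · exact regDet_update_eq_zero (i := 0) (Fin.succ_ne_zero _).symm (by simp) t
  · refine regDet_update_eq_zero (i := i.castSucc.succ) (fun h => ?_) (by simp; ring) t
    have := congrArg Fin.val h
    simp at this

/-- The contribution to the second derivative that lowers two different rows. -/
def lowerPair (n : ℕ) (α β : ℝ) (t : ℂ) : ℂ :=
  match n with
  | 0 => 0
  | n + 1 => regDet β (Fin.cons α (Fin.cons (α + 1) fun i : Fin n => α + 1 + 2 + (i : ℕ))) t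

/-- The parameters are now `α, α+2, α+3, …`. The gap lets the second row drop as well, so at most
two terms survive; with a single row only the first does. -/
lemma hasDerivAt_regDet_lower (n : ℕ) (hβ : 0 < β) (hα : ∀ m : ℤ, α ≠ m) (t : ℂ) :
    HasDerivAt (regDet β (Fin.cons α fun i : Fin n => α + 1 + 1 + (i : ℕ)))
      (-(regDet β (Fin.cons (α - 1) fun i : Fin n => α + 1 + 1 + (i : ℕ)) t +
        lowerPair n α β t)) t := by
  have hne := cons_param_ne n hα hα
  refine (hasDerivAt_regDet hβ hne t).congr_deriv ?_
  rw [Fin.sum_univ_succ, Fin.cons_zero, Fin.update_cons_zero]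
  congr 2
  rcases n with _ | n
  · simp [lowerPair]
  rw [Fin.sum_univ_succ, Finset.sum_eq_zero, add_zero, lowerPair]
  · congr 1
    ext i
    refine Fin.cases ?_ (fun i => Fin.cases ?_ (fun i => ?_) i) i
    · simp
    · simp
    · rw [Function.update_of_ne (by simp [Fin.ext_iff])]
      simp
      ring
  · intro i _
    refine regDet_update_eq_zero (i := i.castSucc.succ) (fun h => ?_) (by simp; ring) t
    have := congrArg Fin.val h
    simp at this

lemma lowerPair_zero (n : ℕ) (hα : 0 < α) (hβ : 0 < β) (hα' : ∀ m : ℤ, α ≠ m) :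
    lowerPair n α β 0 = (jacobiHankel (n + 1) α β *
      ((n + 1) * n * (n + 1 + α + β) * (n + 2 + α + β) / (2 * α * (α + 1))) : ℝ) := by
  rcases n with _ | n
  · simp [lowerPair]
  rw [lowerPair, regDet_zero hβ, betaDet_lower_one_one n hα hβ]
  · congr 1
    push_cast
    ring
  · refine Fin.cases ?_ (Fin.cases ?_ fun i => ?_)
    · rw [Fin.cons_zero]; linarith
    · rw [Fin.cons_succ, Fin.cons_zero]; linarith
    · rw [Fin.cons_succ, Fin.cons_succ]
      have : (0 : ℝ) ≤ ((i : ℕ) : ℝ) := by positivity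
      linarith
  · intro i m h
    refine Fin.cases (fun h => ?_) (fun i => Fin.cases (fun h => ?_) (fun i h => ?_) i) i h
    · exact hα' m h
    · rw [Fin.cons_succ, Fin.cons_zero] at h
      exact hα' (m - 1) (by push_cast; linarith)
    · rw [Fin.cons_succ, Fin.cons_succ] at h
      exact hα' (m - 3 - (i : ℕ)) (by push_cast; linarith)

lemma cons_param_gt (n : ℕ) (hα : 0 < α) {x : ℝ} (hx : -1 < x) (i : Fin (n + 1)) :
    -1 < (Fin.cons x fun i : Fin n => α + 1 + 1 + ((i : ℕ) : ℝ) : Fin (n + 1) → ℝ) i := by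
  refine Fin.cases hx (fun i => ?_) i
  rw [Fin.cons_succ]
  have : (0 : ℝ) ≤ ((i : ℕ) : ℝ) := by positivity
  linarith

/-- The expansion of the regular part of the Hankel determinant up to second order. -/
lemma regDet_taylor (n : ℕ) (hα : 0 < α) (hβ : 0 < β) (hα' : ∀ m : ℤ, α ≠ m) :
    (fun t : ℂ => regDet β (fun i : Fin (n + 1) => α + 1 + ((i : ℕ) : ℝ)) t /
        (jacobiHankel (n + 1) α β : ℝ) -
      (1 - ((n + 1 : ℕ) * ((n + 1 : ℕ) + α + β) : ℂ) * t / α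
        + ((n + 1 : ℕ) * ((n + 1 : ℕ) + α + β) * ((n + 1 : ℕ) * ((n + 1 : ℕ) + α + β) * α + β) : ℂ)
          * t ^ 2 / (2 * α * (α ^ 2 - 1)))) =O[𝓝 0] fun t : ℂ => t ^ 3 := by
  have hD := jacobiHankel_pos (n + 1) hα hβ
  have hT := isBigO_sub_taylor_two (hasDerivAt_regDet_base n hβ hα')
    (fun t => (hasDerivAt_regDet_lower n hβ hα' t).fun_neg)
  have hα1 : ∀ m : ℤ, α - 1 ≠ m := fun m h => hα' (m + 1) (by push_cast; linarith)
  have hα2 : ∀ m : ℤ, α + 1 ≠ m := fun m h => hα' (m - 1) (by push_cast; linarith)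
  rw [regDet_zero hβ (cons_param_gt n hα (by linarith)) (cons_param_ne n hα' hα2),
    regDet_zero hβ (cons_param_gt n hα (by linarith)) (cons_param_ne n hα' hα'),
    regDet_zero hβ (cons_param_gt n hα (by linarith)) (cons_param_ne n hα' hα1),
    lowerPair_zero n hα hβ hα', betaDet_lower_one n hα hβ, betaDet_lower_two n hα hβ hα',
    cons_param_eq, betaDet_jacobi (n + 1) hα hβ] at hT
  refine (hT.const_mul_left ((jacobiHankel (n + 1) α β : ℝ) : ℂ)⁻¹).congr_left fun t => ?_
  have h0 : ((jacobiHankel (n + 1) α β : ℝ) : ℂ) ≠ 0 := by exact_mod_cast hD.ne'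
  have h1 : (α : ℂ) ≠ 0 := by exact_mod_cast hα.ne'
  have h2 : (α : ℂ) - 1 ≠ 0 := by
    have := hα1 0
    rw [Int.cast_zero] at this
    exact_mod_cast this
  have h3 : (α : ℂ) + 1 ≠ 0 := by exact_mod_cast (by linarith : α + 1 ≠ 0)
  have h4 : (α : ℂ) ^ 2 - 1 ≠ 0 := by
    rw [show (α : ℂ) ^ 2 - 1 = (α - 1) * (α + 1) by ring]
    exact mul_ne_zero h2 h3
  push_cast
  generalize ((jacobiHankel (n + 1) α β : ℝ) : ℂ) = D at *
  generalize regDet β (fun i : Fin (n + 1) => α + 1 + ((i : ℕ) : ℝ)) t = W at *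
  rw [show (α : ℂ) ^ 2 - 1 = (α - 1) * (α + 1) by ring]
  field_simp
  ring

end expansion

/-! ### The Hankel determinant -/

lemma hankelD_eq_det_pjInt (n : ℕ) (t : ℂ) (α β : ℝ) :
    hankelD n t α β =
      (Matrix.of fun i j : Fin n => pjInt β (α + 1 + (i : ℕ) + (j : ℕ)) t).det := by
  rw [hankelD]
  congr 1
  ext i j
  rw [Matrix.of_apply, Matrix.of_apply, pjMoment_eq_pjInt]
  push_cast
  rw [add_assoc (α + 1)]

lemma hankelD_zero (n : ℕ) {α β : ℝ} (hα : 0 < α) (hβ : 0 < β) :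
    hankelD n 0 α β = (jacobiHankel n α β : ℝ) := by
  rw [hankelD_eq_det_pjInt, ← betaDet_jacobi n hα hβ, betaDet, ← Complex.ofRealHom_eq_coe,
    RingHom.map_det]
  congr 1
  ext i j
  rw [Matrix.of_apply, pjInt_zero hβ (by positivity)]
  rfl

/-- Reflection at `-(α+1)` turns `Γ(-(α+1))` into `π / (sin(απ) Γ(α+2))`, which supplies the sine
and the second factor `Γ(α+2)`. -/
lemma nonanalyticCoeff_mul (n : ℕ) {α β : ℝ} (hα : 0 < α) (hβ : 0 < β) :
    Real.Gamma (-(α + 1)) * jacobiHankel n (α + 2) β =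
      jacobiHankel (n + 1) α β * nonanalyticCoeff (n + 1) α β := by
  have hrefl := Real.Gamma_mul_Gamma_one_sub (-(α + 1))
  rw [show 1 - -(α + 1) = α + 2 by ring,
    show Real.pi * -(α + 1) = -(α * Real.pi + Real.pi) by ring, Real.sin_neg,
    Real.sin_add_pi, neg_neg] at hrefl
  have hpoch : Real.Gamma (β + 1 + n) =
      (∏ j ∈ Finset.Icc 1 n, (β + (j : ℝ))) * Real.Gamma (β + 1) := by
    induction n with
    | zero => simp
    | succ n ih =>
      rw [Finset.prod_Icc_succ_top (by omega), Nat.cast_succ, ← add_assoc,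
        Real.Gamma_add_one (by positivity), ih]
      ring
  have g1 := (Real.Gamma_pos_of_pos (s := α + 2) (by positivity)).ne'
  rw [jacobiHankel_raise_two n hα hβ, eq_div_of_mul_eq g1 hrefl, nonanalyticCoeff, hpoch,
    Nat.add_sub_cancel, show ((n + 1 : ℕ) : ℝ) + α + 1 = α + n + 2 by push_cast; ring,
    show ((n + 1 : ℕ) : ℝ) + 1 + α + β = α + β + n + 2 by push_cast; ring]
  simp only [div_eq_mul_inv, mul_inv]
  ring

lemma nonanalyticCoeff_ne_zero (n : ℕ) {α β : ℝ} (hα : 0 < α) (hβ : 0 < β)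
    (hα' : ∀ m : ℤ, α ≠ m) : nonanalyticCoeff n α β ≠ 0 := by
  have hsin : Real.sin (α * Real.pi) ≠ 0 := fun h => by
    obtain ⟨m, hm⟩ := Real.sin_eq_zero_iff.1 h
    exact hα' m (mul_right_cancel₀ Real.pi_ne_zero hm).symm
  have g1 := (Real.Gamma_pos_of_pos (s := n + α + 1) (by positivity)).ne'
  have g2 := (Real.Gamma_pos_of_pos (s := n + 1 + α + β) (by positivity)).ne'
  have g3 := (Real.Gamma_pos_of_pos (s := β + 1) (by positivity)).ne'
  have g4 := (Real.Gamma_pos_of_pos (s := α + 1) (by positivity)).ne'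
  have g5 := (Real.Gamma_pos_of_pos (s := α + 2) (by positivity)).ne'
  have g6 : ∏ j ∈ Finset.Icc 1 (n - 1), (β + (j : ℝ)) ≠ 0 :=
    (Finset.prod_pos fun j _ => by positivity).ne'
  have g7 : ((n - 1).factorial : ℝ) ≠ 0 := by positivity
  rw [nonanalyticCoeff]
  have := Real.pi_ne_zero
  positivity

/-! ### Row expansion into regular and singular parts -/

section mixed

variable (n : ℕ) (α β : ℝ)

/-- The matrix of the analytic parts of the moments. -/
def regMatrix (t : ℂ) : Matrix (Fin n) (Fin n) ℂ :=
  Matrix.of fun i j => regPart β (α + 1 + (i : ℕ) + (j : ℕ)) t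

/-- The matrix of the factors of `t^(α+1)` in the moments. -/
def singMatrix (t : ℂ) : Matrix (Fin n) (Fin n) ℂ :=
  Matrix.of fun i j => t ^ ((i : ℕ) + (j : ℕ)) * singPart β (α + 1 + (i : ℕ) + (j : ℕ)) t

/-- The matrix with the rows of `Y` in `s` and the rows of `X` elsewhere. -/
def mixRows {n : ℕ} (s : Finset (Fin n)) (Y X : Matrix (Fin n) (Fin n) ℂ) :
    Matrix (Fin n) (Fin n) ℂ :=
  Matrix.of fun i j => if i ∈ s then Y i j else X i j

/-- The determinant whose rows in `s` are singular and whose other rows are regular. -/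
def mixedDet (s : Finset (Fin n)) (t : ℂ) : ℂ :=
  (mixRows s (singMatrix n α β t) (regMatrix n α β t)).det

lemma det_add_smul_eq_sum (X Y : Matrix (Fin n) (Fin n) ℂ) (u : ℂ) :
    (X + u • Y).det = ∑ s : Finset (Fin n), u ^ s.card * (mixRows s Y X).det := by
  let f := (Matrix.detRowAlternating (n := Fin n) (R := ℂ)).toMultilinearMap
  have hf : ∀ Z : Fin n → Fin n → ℂ, f Z = (Matrix.of Z).det := fun _ => rfl
  have h := f.map_add_univ (fun i j => u * Y i j) fun i j => X i j
  rw [hf] at h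
  have hXY : X + u • Y = Matrix.of ((fun i j => u * Y i j) + fun i j => X i j) := by
    ext i j
    simp [add_comm]
  rw [hXY]
  refine h.trans (Finset.sum_congr rfl fun s _ => ?_)
  have h2 := f.map_piecewise_smul (fun _ => u) (fun i j => mixRows s Y X i j) s
  rw [Finset.prod_const, smul_eq_mul] at h2
  refine Eq.trans ?_ h2
  congr 1
  ext i j
  by_cases hi : i ∈ s <;> simp [hi, mixRows]

variable {n α β}

lemma hankelD_eq_sum_mixedDet (hα : 0 < α) (hβ : 0 < β) (hα' : ∀ m : ℤ, α ≠ m) {t : ℂ}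
    (ht : 0 ≤ t.re) (ht' : t ∈ Complex.slitPlane) :
    hankelD n t α β = ∑ s : Finset (Fin n), (t ^ ((α : ℂ) + 1)) ^ s.card * mixedDet n α β s t := by
  have h := det_add_smul_eq_sum n (regMatrix n α β t) (singMatrix n α β t) (t ^ ((α : ℂ) + 1))
  rw [hankelD_eq_det_pjInt]
  refine Eq.trans ?_ h
  congr 1
  ext i j
  have ht0 : t ≠ 0 := Complex.slitPlane_ne_zero ht'
  have hne : ∀ m : ℤ, α + 1 + ((i : ℕ) : ℝ) + ((j : ℕ) : ℝ) ≠ m := fun m h =>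
    hα' (m - 1 - (i : ℕ) - (j : ℕ)) (by push_cast; linarith)
  have hi : (0 : ℝ) ≤ ((i : ℕ) : ℝ) := by positivity
  have hj : (0 : ℝ) ≤ ((j : ℕ) : ℝ) := by positivity
  rw [Matrix.of_apply, pjInt_eq hβ (by linarith) hne ht ht']
  simp only [Matrix.add_apply, Matrix.smul_apply, regMatrix, singMatrix, Matrix.of_apply,
    smul_eq_mul]
  push_cast
  rw [show (α : ℂ) + 1 + (i : ℕ) + (j : ℕ) = (α + 1) + (((i : ℕ) + (j : ℕ) : ℕ) : ℂ) by
    push_cast; ring, Complex.cpow_add _ _ ht0, Complex.cpow_natCast]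
  ring

lemma differentiable_mixedDet (hα : 0 < α) (hβ : 0 < β) (hα' : ∀ m : ℤ, α ≠ m)
    (s : Finset (Fin n)) : Differentiable ℂ (mixedDet n α β s) := by
  refine differentiable_det (M := fun t => mixRows s (singMatrix n α β t) (regMatrix n α β t))
    fun i j => ?_
  have hne : ∀ m : ℤ, α + 1 + ((i : ℕ) : ℝ) + ((j : ℕ) : ℝ) ≠ m := fun m h =>
    hα' (m - 1 - (i : ℕ) - (j : ℕ)) (by push_cast; linarith)
  by_cases hi : i ∈ s
  · simp only [mixRows, hi, if_true, singMatrix, Matrix.of_apply]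
    exact (differentiable_id.pow _).mul (differentiable_singPart hβ (by positivity))
  · simp only [mixRows, hi, if_false, regMatrix, Matrix.of_apply]
    exact differentiable_regPart hβ hne

lemma mixedDet_empty :
    mixedDet n α β ∅ = regDet β fun i : Fin n => α + 1 + ((i : ℕ) : ℝ) := by
  ext t
  rw [mixedDet, regDet]
  congr 1

lemma mixedDet_singleton_zero_of_ne {i : Fin (n + 1)} (hi : i ≠ 0) :
    mixedDet (n + 1) α β {i} 0 = 0 := by
  refine Matrix.det_eq_zero_of_row_eq_zero i fun j => ?_
  have : (i : ℕ) + (j : ℕ) ≠ 0 := by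
    have := Fin.val_ne_of_ne hi
    rw [Fin.val_zero] at this
    omega
  simp only [mixRows, Matrix.of_apply, Finset.mem_singleton, if_true, singMatrix, zero_pow this,
    zero_mul]

/-- At `t = 0` the factor `t^j` reduces row `0` to its first entry `Γ(-(α+1))`. Deleting the first
row and column raises the Beta parameters by two, which is the replacement of `α` by `α + 2`. -/
lemma mixedDet_singleton_zero (hα : 0 < α) (hβ : 0 < β) (hα' : ∀ m : ℤ, α ≠ m) :
    mixedDet (n + 1) α β {0} 0 =
      (jacobiHankel (n + 1) α β * nonanalyticCoeff (n + 1) α β : ℝ) := by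
  rw [← nonanalyticCoeff_mul n hα hβ, mixedDet, Matrix.det_succ_row_zero, Fin.sum_univ_succ,
    Finset.sum_eq_zero fun j _ => ?_, add_zero, ← betaDet_jacobi n (by positivity) hβ,
    Complex.ofReal_mul, ← singPart_zero β (α + 1), ← regDet_zero hβ]
  · have h1 : mixRows {0} (singMatrix (n + 1) α β 0) (regMatrix (n + 1) α β 0) 0 0 =
        singPart β (α + 1) 0 := by
      simp [mixRows, singMatrix]
    rw [h1, Fin.val_zero, pow_zero, one_mul]
    congr 1
    rw [regDet]
    congr 1
    ext i j
    simp only [Matrix.submatrix_apply, mixRows, Matrix.of_apply, Finset.mem_singleton, Fin.succ_ne_zero,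
      if_false, regMatrix, Fin.succAbove_zero, Fin.val_succ]
    congr 1
    push_cast
    ring
  · intro i
    have : (0 : ℝ) ≤ ((i : ℕ) : ℝ) := by positivity
    linarith
  · intro i m h
    exact hα' (m - 3 - (i : ℕ)) (by push_cast; linarith)
  · have h1 : mixRows {0} (singMatrix (n + 1) α β 0) (regMatrix (n + 1) α β 0) 0 j.succ = 0 := by
      simp [mixRows, singMatrix]
    rw [h1, mul_zero, zero_mul]

lemma sum_mixedDet_singleton_zero (hα : 0 < α) (hβ : 0 < β) (hα' : ∀ m : ℤ, α ≠ m) :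
    ∑ i, mixedDet (n + 1) α β {i} 0 =
      (jacobiHankel (n + 1) α β * nonanalyticCoeff (n + 1) α β : ℝ) := by
  rw [← mixedDet_singleton_zero hα hβ hα', Finset.sum_eq_single 0
    (fun i _ hi => mixedDet_singleton_zero_of_ne hi) (fun h => absurd (Finset.mem_univ _) h)]

/-- Splitting a sum over all subsets by cardinality zero, one, and at least two. -/
lemma sum_finset_eq_add_add {M : Type*} [AddCommMonoid M] (f : Finset (Fin n) → M) :
    ∑ s, f s = f ∅ + ∑ i, f {i} + ∑ s ∈ Finset.univ.filter fun s => 2 ≤ s.card, f s := by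
  classical
  rw [← Finset.sum_filter_add_sum_filter_not Finset.univ fun s : Finset (Fin n) => 2 ≤ s.card,
    add_comm]
  congr 1
  have h1 : (Finset.univ.filter fun s : Finset (Fin n) => ¬ 2 ≤ s.card) =
      insert ∅ (Finset.univ.map ⟨fun i : Fin n => ({i} : Finset (Fin n)),
        Finset.singleton_injective⟩) := by
    ext s
    simp only [Finset.mem_filter, Finset.mem_univ, true_and, Finset.mem_insert, Finset.mem_map,
      Function.Embedding.coeFn_mk, not_le]
    constructor
    · intro h
      have h2 : s.card = 0 ∨ s.card = 1 := by omega
      rcases h2 with h2 | h2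
      · exact Or.inl (Finset.card_eq_zero.1 h2)
      · obtain ⟨i, hi⟩ := Finset.card_eq_one.1 h2
        exact Or.inr ⟨i, hi.symm⟩
    · rintro (rfl | ⟨i, rfl⟩) <;> simp
  rw [h1, Finset.sum_insert (by simp), Finset.sum_map]
  rfl

lemma isBigO_mixedDet_term (hα : 0 < α) (hβ : 0 < β) (hα' : ∀ m : ℤ, α ≠ m)
    {s : Finset (Fin n)} (hs : 2 ≤ s.card) :
    (fun t : ℂ => (t ^ ((α : ℂ) + 1)) ^ s.card * mixedDet n α β s t)
      =O[𝓝[Complex.slitPlane] 0] fun t : ℂ => ‖t‖ ^ (2 * (α + 1)) := by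
  have h1 : mixedDet n α β s =O[𝓝[Complex.slitPlane] 0] fun _ => (1 : ℝ) :=
    (((differentiable_mixedDet hα hβ hα' s) 0).continuousAt.isBigO_one ℝ).mono nhdsWithin_le_nhds
  have h2 : (fun t : ℂ => (t ^ ((α : ℂ) + 1)) ^ s.card) =O[𝓝[Complex.slitPlane] 0]
      fun t : ℂ => ‖t‖ ^ (2 * (α + 1)) := by
    refine IsBigO.of_bound 1 ?_
    have hball : ∀ᶠ t : ℂ in 𝓝[Complex.slitPlane] 0, ‖t‖ < 1 :=
      nhdsWithin_le_nhds (by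
        filter_upwards [Metric.ball_mem_nhds (0 : ℂ) one_pos] with t ht
        simpa using ht)
    filter_upwards [hball] with t ht
    have e : (α : ℂ) + 1 = ((α + 1 : ℝ) : ℂ) := by push_cast; rfl
    rw [norm_pow, e, Complex.norm_cpow_real, one_mul, Real.norm_eq_abs,
      abs_of_nonneg (Real.rpow_nonneg (norm_nonneg _) _), mul_comm, Real.rpow_mul (norm_nonneg _),
      ← Real.rpow_natCast (_ : ℝ) s.card]
    refine Real.rpow_le_rpow_of_exponent_ge' (by positivity)
      (Real.rpow_le_one (norm_nonneg _) ht.le (by positivity)) (by norm_num) ?_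
    exact_mod_cast hs
  simpa using h2.mul h1

end mixed

end

theorem theorem7 (n : ℕ) (hn : 1 ≤ n) (α β : ℝ) (hα : 0 < α) (hβ : 0 < β) :
    ((∀ m : ℤ, α ≠ (m : ℝ)) →
      ∃ D A B R : ℂ → ℂ,
        -- `D` is the analytic continuation of `t ↦ D_n(t, α, β)` to `|arg t| < π`
        DifferentiableOn ℂ D Complex.slitPlane ∧
        (∀ t ∈ Complex.slitPlane, 0 ≤ t.re → D t = hankelD n t α β) ∧
        -- the power series part `A`, the series `B` multiplying `t^{α+1}`, and the remainder `R`
        AnalyticAt ℂ A 0 ∧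
        AnalyticAt ℂ B 0 ∧
        (fun t : ℂ => A t -
            (1 - (n * (n + α + β) : ℂ) * t / α
              + (n * (n + α + β) * (n * (n + α + β) * α + β) : ℂ) * t ^ 2
                  / (2 * α * (α ^ 2 - 1))))
          =O[𝓝 0] (fun t : ℂ => t ^ 3) ∧
        (fun t : ℂ => B t - 1) =O[𝓝 0] (fun t : ℂ => t) ∧
        R =O[𝓝[Complex.slitPlane] 0] (fun t : ℂ => ‖t‖ ^ (2 * (α + 1))) ∧
        ∀ᶠ t in 𝓝[Complex.slitPlane] (0 : ℂ),
          D t = hankelD n 0 α β *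
            (A t + (nonanalyticCoeff n α β : ℂ) * t ^ ((α : ℂ) + 1) * B t + R t)) ∧
    hankelD n 0 α β =
      (4 : ℂ) ^ (-((n : ℂ) * (n + α + β))) * (2 * (Real.pi : ℂ)) ^ n
        * (Complex.Gamma ((α + β + 1) / 2) * barnesG ((α + β + 1) / 2) ^ 2
            * barnesG ((α + β) / 2 + 1) ^ 2
          / (barnesG (α + β + 1) * barnesG (α + 1) * barnesG (β + 1)))
        * (barnesG (n + 1) * barnesG (n + α + 1) * barnesG (n + β + 1) * barnesG (n + α + β + 1)
          / (barnesG (n + (α + β + 1) / 2) ^ 2 * barnesG (n + 1 + (α + β) / 2) ^ 2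
            * Complex.Gamma (n + (α + β + 1) / 2))) := by
  refine ⟨fun hα' => ?_, (hankelD_zero n hα hβ).trans (jacobiHankel_eq_barnesG n hα hβ)⟩
  obtain ⟨n, rfl⟩ : ∃ k, n = k + 1 := ⟨n - 1, by omega⟩
  have hD0 : ((jacobiHankel (n + 1) α β : ℝ) : ℂ) ≠ 0 := by
    exact_mod_cast (jacobiHankel_pos (n + 1) hα hβ).ne'
  have hc0 : ((nonanalyticCoeff (n + 1) α β : ℝ) : ℂ) ≠ 0 := by
    exact_mod_cast nonanalyticCoeff_ne_zero (n + 1) hα hβ hα'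
  set D0 : ℂ := ((jacobiHankel (n + 1) α β : ℝ) : ℂ) with hD0def
  set c : ℂ := ((nonanalyticCoeff (n + 1) α β : ℝ) : ℂ) with hcdef
  have hdiff := fun s => differentiable_mixedDet (n := n + 1) hα hβ hα' s
  have hA : Differentiable ℂ fun t => mixedDet (n + 1) α β ∅ t / D0 := (hdiff ∅).div_const D0
  -- Dividing by `D0 * c` normalises `B(0) = 1`, which requires the coefficient `c` to be nonzero.
  have hB : Differentiable ℂ fun t => (∑ i, mixedDet (n + 1) α β {i} t) / (D0 * c) :=
    (Differentiable.fun_sum fun i _ => hdiff {i}).div_const _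
  refine ⟨fun t => ∑ s, (t ^ ((α : ℂ) + 1)) ^ s.card * mixedDet (n + 1) α β s t,
    fun t => mixedDet (n + 1) α β ∅ t / D0,
    fun t => (∑ i, mixedDet (n + 1) α β {i} t) / (D0 * c),
    fun t => (∑ s ∈ Finset.univ.filter fun s => 2 ≤ s.card,
      (t ^ ((α : ℂ) + 1)) ^ s.card * mixedDet (n + 1) α β s t) / D0,
    fun t ht => ?_, fun t ht ht0 => (hankelD_eq_sum_mixedDet hα hβ hα' ht0 ht).symm,
    hA.analyticAt 0, hB.analyticAt 0, ?_, ?_, ?_, ?_⟩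
  · have hcp : DifferentiableAt ℂ (fun t : ℂ => t ^ ((α : ℂ) + 1)) t :=
      differentiableAt_id.cpow (differentiableAt_const _) ht
    exact (DifferentiableAt.fun_sum fun s _ =>
      (hcp.pow s.card).mul (hdiff s t)).differentiableWithinAt
  · rw [mixedDet_empty]
    exact regDet_taylor n hα hβ hα'
  · have h := (hB 0).isBigO_sub
    have h1 : (∑ i, mixedDet (n + 1) α β {i} 0) / (D0 * c) = 1 := by
      rw [sum_mixedDet_singleton_zero hα hβ hα', Complex.ofReal_mul]
      exact div_self (mul_ne_zero hD0 hc0)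
    simpa only [h1, sub_zero] using h
  · refine IsBigO.congr_left (f₁ := fun t => D0⁻¹ * ∑ s ∈ Finset.univ.filter fun s => 2 ≤ s.card,
      (t ^ ((α : ℂ) + 1)) ^ s.card * mixedDet (n + 1) α β s t) ?_ fun t => by
        rw [div_eq_inv_mul]
    refine (IsBigO.fun_sum fun s hs => ?_).const_mul_left _
    exact isBigO_mixedDet_term hα hβ hα' (Finset.mem_filter.1 hs).2
  -- The decomposition by `|s|` is an algebraic identity valid for every `t`, so no smallness is
  -- needed here.
  · refine Eventually.of_forall fun t => ?_
    rw [hankelD_zero (n + 1) hα hβ, ← hD0def]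
    beta_reduce
    rw [sum_finset_eq_add_add]
    simp only [Finset.card_empty, pow_zero, one_mul, Finset.card_singleton, pow_one]
    rw [← Finset.mul_sum]
    field_simp
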